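/- Let $R$ be a commutative Noetherian ring, $M$ a finitely generated $R$-module and $I$ an ideal of $R$. For a submodule $N\subseteq M$, the index of reducibility $\mathrm{ir}_M(N)$ is the number of submodules in an irredundant decomposition of $N$ as a finite intersection of irreducible submodules of $M$ (proper submodules that are not the intersection of two strictly larger submodules); this number does not depend on the decomposition, and $\mathrm{ir}_M(M)=0$. Let $\mathrm{bight}_M(I)$ be the maximum of the Krull dimensions $\dim_{R_{\mathfrak p}} M_{\mathfrak p}$ over the minimal elements $\mathfrak p$ of $\mathrm{Ass}_R(M/IM)$. Let $A_M(I)$ be the stable value of $\mathrm{Ass}_R(M/I^nM)$ for $n\gg 0$. If $(R,\mathfrak m)$ is local, put $\ell_M(I)=\dim_{G(I)}\bigl(G_M(I)/\mathfrak m G_M(I)\bigr)$, where $G(I)=\bigoplus_{n\ge 0} I^n/I^{n+1}$ and $G_M(I)=\bigoplus_{n\ge 0} I^nM/I^{n+1}M$; in general, the analytic spread $\ell_M(I)$ is the maximum of $\ell_{M_{\mathfrak m}}(IR_{\mathfrak m})$ over the maximal ideals $\mathfrak m$ of $R$ that contain some $\mathfrak p\in A_M(I)$. (The maximum of the empty set,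 the dimension of the zero module and the degree of the zero polynomial are $-\infty$.) Theorem. There is a polynomial $\mathrm{Ir}_{M,I}\in\mathbb Q[n]$ with $\mathrm{Ir}_{M,I}(n)=\mathrm{ir}_M(I^nM)$ for all sufficiently large $n$. Moreover $$\mathrm{bight}_M(I)-1\le \deg \mathrm{Ir}_{M,I},$$ and, if $\ell_M(I)\neq 0$, $$\deg \mathrm{Ir}_{M,I}\le \ell_M(I)-1 .$$ -/

import Mathlib

open Filter Polynomial

namespace ReducibilityIndex

section Irreducible

variable {R : Type*} [CommRing R] {M : Type*} [AddCommGroup M] [Module R M]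

/-- `s` is an irredundant irreducible decomposition of the submodule `N`: the members of `s` are
irreducible (proper, and not an intersection of two strictly larger submodules), their
intersection is `N`, and no member can be left out. The empty family decomposes `⊤`. -/
structure IsIrredundantIrreducibleDecomposition (N : Submodule R M)
    (s : Finset (Submodule R M)) : Prop where
  infIrred : ∀ Q ∈ s, InfIrred Q
  inf_eq : s.inf id = N
  irredundant : ∀ t, t ⊂ s → t.inf id ≠ N

theorem exists_isIrredundantIrreducibleDecomposition [IsNoetherian R M] (N : Submodule R M) :
    ∃ s, IsIrredundantIrreducibleDecomposition N s := by
  obtain ⟨s, hs, hirr⟩ := exists_infIrred_decomposition N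
  induction s using Finset.strongInduction with
  | H s ih =>
    by_cases h : ∃ t, t ⊂ s ∧ t.inf id = N
    · obtain ⟨t, hts, ht⟩ := h
      exact ih t hts ht fun b hb => hirr (hts.1 hb)
    · exact ⟨s, fun Q hQ => hirr hQ, hs, fun t hts ht => h ⟨t, hts, ht⟩⟩

theorem eq_or_eq_of_inf_eq {a b c d x : Submodule R M} (hx : InfIrred x)
    (hbx : b ⊓ x = a) (hc : c ≤ b) (hd : d ≤ b) (hcd : c ⊓ d = a) : c = a ∨ d = a := by
  have hac : a ≤ c := hcd ▸ inf_le_left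
  have had : a ≤ d := hcd ▸ inf_le_right
  have hax : a ≤ x := hbx ▸ inf_le_right
  have key : (x ⊔ c) ⊓ (x ⊔ d) = x := by
    refine le_antisymm ?_ (le_inf le_sup_left le_sup_left)
    rintro z ⟨hz1, hz2⟩
    obtain ⟨x1, hx1, c1, hc1, rfl⟩ := Submodule.mem_sup.1 hz1
    obtain ⟨x2, hx2, d1, hd1, h⟩ := Submodule.mem_sup.1 hz2
    have e : c1 - d1 = x2 - x1 := by
      rw [sub_eq_sub_iff_add_eq_add, h, add_comm]
    have h1 : c1 - d1 ∈ a := by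
      rw [← hbx]
      exact ⟨b.sub_mem (hc hc1) (hd hd1), e ▸ x.sub_mem hx2 hx1⟩
    have h2 : c1 ∈ d := by simpa using d.add_mem (had h1) hd1
    have h3 : c1 ∈ a := hcd ▸ ⟨hc1, h2⟩
    exact x.add_mem hx1 (hax h3)
  rcases hx.2 key with h | h
  · exact Or.inl (le_antisymm (hbx ▸ le_inf hc (sup_eq_left.1 h)) hac)
  · exact Or.inr (le_antisymm (hbx ▸ le_inf hd (sup_eq_left.1 h)) had)

theorem eq_or_exists_inf_eq {a b x : Submodule R M} (hx : InfIrred x)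
    (hbx : b ⊓ x = a) (t : Finset (Submodule R M)) (ht : b ⊓ t.inf id = a) :
    b = a ∨ ∃ y ∈ t, b ⊓ y = a := by
  classical
  induction t using Finset.induction_on with
  | empty => left; simpa using ht
  | insert y t _ ih =>
    rw [Finset.inf_insert, id, inf_inf_distrib_left] at ht
    rcases eq_or_eq_of_inf_eq hx hbx inf_le_left inf_le_left ht with h | h
    · exact Or.inr ⟨y, Finset.mem_insert_self _ _, h⟩
    · exact (ih h).imp_right fun ⟨z, hz, h⟩ => ⟨z, Finset.mem_insert_of_mem hz, h⟩

theorem exists_subset_card_le {N : Submodule R M} {t : Finset (Submodule R M)}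
    (ht : t.inf id = N) (s : Finset (Submodule R M)) : ∀ u ⊆ t, (∀ Q ∈ s, InfIrred Q) →
    s.inf id ⊓ u.inf id = N → ∃ v ⊆ t, v.inf id = N ∧ v.card ≤ s.card + u.card := by
  classical
  induction s using Finset.induction_on with
  | empty => intro u hu _ h; exact ⟨u, hu, by simpa using h, by simp⟩
  | insert x s hxs ih =>
    intro u hu hirr h
    have hirr' : ∀ Q ∈ s, InfIrred Q := fun Q hQ => hirr Q (Finset.mem_insert_of_mem hQ)
    have hb : (s.inf id ⊓ u.inf id) ⊓ x = N := by
      rw [← h, Finset.inf_insert, id, inf_comm _ x, inf_assoc]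
    rcases eq_or_exists_inf_eq (hirr x (Finset.mem_insert_self _ _)) hb t
      (by rw [ht]; exact inf_eq_right.2 (hb ▸ inf_le_left)) with h' | ⟨y, hy, h'⟩
    · obtain ⟨v, hv, hv1, hv2⟩ := ih u hu hirr' h'
      exact ⟨v, hv, hv1, hv2.trans (by rw [Finset.card_insert_of_notMem hxs]; lia)⟩
    · obtain ⟨v, hv, hv1, hv2⟩ := ih (insert y u) (Finset.insert_subset hy hu) hirr'
        (by rw [← h', Finset.inf_insert, id, inf_comm y, inf_assoc])
      refine ⟨v, hv, hv1, hv2.trans ?_⟩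
      have := Finset.card_insert_le y u
      rw [Finset.card_insert_of_notMem hxs]
      lia

/-- Noether: the number of components does not depend on the decomposition. -/
theorem IsIrredundantIrreducibleDecomposition.card_eq {N : Submodule R M}
    {s t : Finset (Submodule R M)} (hs : IsIrredundantIrreducibleDecomposition N s)
    (ht : IsIrredundantIrreducibleDecomposition N t) : s.card = t.card := by
  have main : ∀ {s t : Finset (Submodule R M)}, IsIrredundantIrreducibleDecomposition N s →
      IsIrredundantIrreducibleDecomposition N t → t.card ≤ s.card := by
    intro s t hs ht
    obtain ⟨v, hv, hv1, hv2⟩ := exists_subset_card_le ht.inf_eq s ∅ (by simp) hs.infIrred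
      (by simpa using hs.inf_eq)
    have : v = t := by
      by_contra hne
      exact ht.irredundant v (hv.ssubset_of_ne hne) hv1
    simpa [this] using hv2
  exact le_antisymm (main ht hs) (main hs ht)

/-- The index of reducibility `ir_M(N)`: the number of components of an (equivalently, by
`indexOfReducibility_eq_card`, of every) irredundant irreducible decomposition of `N`. -/
noncomputable def indexOfReducibility [IsNoetherian R M] (N : Submodule R M) : ℕ :=
  (exists_isIrredundantIrreducibleDecomposition N).choose.card

theorem indexOfReducibility_eq_card [IsNoetherian R M] {N : Submodule R M}
    {s : Finset (Submodule R M)} (hs : IsIrredundantIrreducibleDecomposition N s) :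
    indexOfReducibility N = s.card :=
  (exists_isIrredundantIrreducibleDecomposition N).choose_spec.card_eq hs

end Irreducible

section BigHeight

variable {R : Type*} [CommRing R] (I : Ideal R) (M : Type*) [AddCommGroup M] [Module R M]

/-- The big height `bight_M(I)`: the maximum of the Krull dimensions `dim M_𝔭` over the minimal
elements `𝔭` of `Ass(M/IM)`. It is `⊥` (minus infinity) if there are none, that is, if
`M = IM`. -/
noncomputable def bigHeight : WithBot ℕ∞ :=
  ⨆ (p : PrimeSpectrum R)
    (_ : Minimal (· ∈ associatedPrimes R (M ⧸ (I • ⊤ : Submodule R M))) p.asIdeal),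
    Module.supportDim (Localization p.asIdeal.primeCompl)
      (LocalizedModule p.asIdeal.primeCompl M)

/-- The stable value `A_M(I)` of `Ass(M/IⁿM)` for large `n`: the primes that belong to
`Ass(M/IⁿM)` for all sufficiently large `n`. -/
def stableAssociatedPrimes : Set (Ideal R) :=
  {p | ∀ᶠ n : ℕ in atTop, p ∈ associatedPrimes R (M ⧸ (I ^ n • ⊤ : Submodule R M))}

end BigHeight

section AnalyticSpread

variable {R : Type*} [CommRing R] (I : Ideal R) (M : Type*) [AddCommGroup M] [Module R M]

/-- The associated graded ring `G(I) = ⨁ Iⁿ/Iⁿ⁺¹`, as the quotient of the Rees algebra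
`⨁ Iⁿ tⁿ` by its ideal `⨁ Iⁿ⁺¹ tⁿ` generated by `I`. -/
def AssociatedGradedRing : Type _ :=
  reesAlgebra I ⧸ I.map (algebraMap R (reesAlgebra I))

noncomputable instance : CommRing (AssociatedGradedRing I) :=
  inferInstanceAs (CommRing (reesAlgebra I ⧸ I.map (algebraMap R (reesAlgebra I))))

noncomputable instance : Algebra R (AssociatedGradedRing I) :=
  inferInstanceAs (Algebra R (reesAlgebra I ⧸ I.map (algebraMap R (reesAlgebra I))))

/-- The Rees module `⨁ IⁿM tⁿ` over the Rees algebra: the polynomials `∑ mₙ tⁿ` with `mₙ ∈ IⁿM`. -/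
def ReesModule : Type _ :=
  (I.stableFiltration (⊤ : Submodule R M)).submodule

noncomputable instance : AddCommGroup (ReesModule I M) :=
  inferInstanceAs (AddCommGroup (I.stableFiltration (⊤ : Submodule R M)).submodule)

noncomputable instance : Module (reesAlgebra I) (ReesModule I M) :=
  inferInstanceAs (Module (reesAlgebra I) (I.stableFiltration (⊤ : Submodule R M)).submodule)

/-- The associated graded module `G_M(I) = ⨁ IⁿM/Iⁿ⁺¹M` over `G(I)`, as the quotient of the
Rees module `⨁ IⁿM tⁿ` by its submodule `I · ⨁ IⁿM tⁿ = ⨁ Iⁿ⁺¹M tⁿ`. -/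
def AssociatedGradedModule : Type _ :=
  ReesModule I M ⧸
    (I.map (algebraMap R (reesAlgebra I)) • ⊤ : Submodule (reesAlgebra I) (ReesModule I M))

noncomputable instance : AddCommGroup (AssociatedGradedModule I M) :=
  inferInstanceAs (AddCommGroup (ReesModule I M ⧸
    (I.map (algebraMap R (reesAlgebra I)) • ⊤ : Submodule (reesAlgebra I) (ReesModule I M))))

noncomputable instance : Module (AssociatedGradedRing I) (AssociatedGradedModule I M) :=
  inferInstanceAs (Module (reesAlgebra I ⧸ I.map (algebraMap R (reesAlgebra I))) (ReesModule I M ⧸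
    (I.map (algebraMap R (reesAlgebra I)) • ⊤ : Submodule (reesAlgebra I) (ReesModule I M))))

/-- The analytic spread over a local ring `(R, 𝔪)`: the Krull dimension over `G(I)` of
`G_M(I)/𝔪 G_M(I)`. -/
noncomputable def localAnalyticSpread [IsLocalRing R] : WithBot ℕ∞ :=
  Module.supportDim (AssociatedGradedRing I)
    (AssociatedGradedModule I M ⧸
      ((IsLocalRing.maximalIdeal R).map (algebraMap R (AssociatedGradedRing I)) • ⊤ :
        Submodule (AssociatedGradedRing I) (AssociatedGradedModule I M)))

/-- The analytic spread `ℓ_M(I)`: the maximum of the analytic spreads of `I R_𝔪` on `M_𝔪` over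
the maximal ideals `𝔪` that contain some prime of `A_M(I)`. It is `⊥` (minus infinity) if there
are none, that is, if `M = IM`. -/
noncomputable def analyticSpread : WithBot ℕ∞ :=
  ⨆ (m : MaximalSpectrum R) (_ : ∃ p ∈ stableAssociatedPrimes I M, p ≤ m.asIdeal),
    localAnalyticSpread (I.map (algebraMap R (Localization.AtPrime m.asIdeal)))
      (LocalizedModule m.asIdeal.primeCompl M)

end AnalyticSpread

end ReducibilityIndex

/-!
The index of reducibility of `K` is the sum over `p ∈ Ass(M/K)` of the length of the socle of
`(M/K)_p`, because an irredundant irreducible decomposition of `K` lifts to bases of these socles.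
Only finitely many primes occur for the submodules `Iⁿ M`, so everything happens over a local ring
`(A, 𝔪)`, with socle length `s(n) = λ((Iⁿ N : 𝔪) / Iⁿ N)`, where `λ` is the length.

* Polynomiality: by Artin–Rees the submodules `Iⁿ N : 𝔪` agree, up to the eventually constant
  contribution of the finite length submodule `0 : 𝔪`, with a stable `I`-filtration, to which the
  Hilbert function argument applies.
* Lower bound: if `N / I N` has finite length then `λ(Iⁿ N / Iⁿ⁺¹ N) ≤ C s(n + 1)`, so
  `λ(N / Iⁿ N)` is `O(n ^ (deg s + 1))`, and this exponent dominates `dim N`.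
* Upper bound: Artin–Rees over the Rees algebra gives `s(n + c) ≤ a μ(Iⁿ N) + b`, with `μ` the
  minimal number of generators, and `μ(Iⁿ N)` summed over `n` grows no faster than the dimension of
  the fiber cone allows, as one sees from a Noether normalization.
-/

namespace ReducibilityIndex

open IsLocalRing

section RelativeLength

variable {A : Type*} [CommRing A] {N N' : Type*} [AddCommGroup N] [Module A N]
  [AddCommGroup N'] [Module A N']

/-- The length of `J / (K ∩ J)`. It measures how far `J` sticks out of `K`, without requiring that
`K` be contained in `J`. -/
noncomputable def relativeLength (K J : Submodule A N) : ℕ∞ :=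
  Module.length A (J ⧸ K.submoduleOf J)

theorem relativeLength_eq_length_range {K J : Submodule A N} (g : J →ₗ[A] N')
    (hg : LinearMap.ker g = K.submoduleOf J) :
    relativeLength K J = Module.length A (LinearMap.range g) := by
  rw [relativeLength, ← hg]
  exact g.quotKerEquivRange.length_eq

theorem relativeLength_eq_length_map (K J : Submodule A N) :
    relativeLength K J = Module.length A (J.map K.mkQ) := by
  rw [relativeLength_eq_length_range (K.mkQ ∘ₗ J.subtype)
    (by rw [LinearMap.ker_comp, Submodule.ker_mkQ]; rfl), LinearMap.range_comp,
    Submodule.range_subtype]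

theorem relativeLength_top (K : Submodule A N) :
    relativeLength K ⊤ = Module.length A (N ⧸ K) := by
  rw [relativeLength_eq_length_map, Submodule.map_top, Submodule.range_mkQ, Module.length_top]

theorem relativeLength_eq_zero_iff {K J : Submodule A N} : relativeLength K J = 0 ↔ J ≤ K := by
  rw [relativeLength, Module.length_eq_zero_iff, Submodule.Quotient.subsingleton_iff,
    Submodule.submoduleOf_eq_top]

theorem relativeLength_mono {K J J' : Submodule A N} (h : J ≤ J') :
    relativeLength K J ≤ relativeLength K J' := by
  rw [relativeLength_eq_length_map, relativeLength_eq_length_map]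
  exact Module.length_le_of_injective (Submodule.inclusion (Submodule.map_mono h))
    (Submodule.inclusion_injective _)

theorem relativeLength_anti {K K' J : Submodule A N} (h : K ≤ K') :
    relativeLength K' J ≤ relativeLength K J :=
  Module.length_le_of_surjective (Submodule.factor (Submodule.comap_mono h))
    (Submodule.factor_surjective _)

theorem relativeLength_sup (K J : Submodule A N) :
    relativeLength K (J ⊔ K) = relativeLength K J := by
  rw [relativeLength_eq_length_map, relativeLength_eq_length_map, Submodule.map_sup,
    Submodule.mkQ_map_self, sup_bot_eq]

theorem relativeLength_inf_left (K J : Submodule A N) :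
    relativeLength (J ⊓ K) J = relativeLength K J := by
  have h : (J ⊓ K).submoduleOf J = K.submoduleOf J := by
    ext x
    simp [Submodule.submoduleOf]
  rw [relativeLength, h, relativeLength]

theorem relativeLength_map (f : N →ₗ[A] N') (K : Submodule A N') (J : Submodule A N) :
    relativeLength K (J.map f) = relativeLength (K.comap f) J := by
  rw [relativeLength_eq_length_map K,
    relativeLength_eq_length_range (K.mkQ ∘ₗ f ∘ₗ J.subtype) (by
      rw [LinearMap.ker_comp, Submodule.ker_mkQ]; rfl),
    LinearMap.range_comp, LinearMap.range_comp, Submodule.range_subtype]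

theorem length_quotient_eq_add {K L : Submodule A N} (h : K ≤ L) :
    Module.length A (N ⧸ K) = relativeLength K L + Module.length A (N ⧸ L) := by
  rw [relativeLength_eq_length_map, ← (Submodule.quotientQuotientEquivQuotient K L h).length_eq]
  exact Module.length_eq_add_of_exact (L.map K.mkQ).subtype (L.map K.mkQ).mkQ
    (Submodule.subtype_injective _) (Submodule.mkQ_surjective _)
    (LinearMap.exact_subtype_mkQ _)

theorem relativeLength_eq_add {K L J : Submodule A N} (h : K ≤ L) (h' : L ≤ J) :
    relativeLength K J = relativeLength K L + relativeLength L J := by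
  have hL : relativeLength K L = relativeLength (K.submoduleOf J) (L.submoduleOf J) := by
    rw [Submodule.submoduleOf, Submodule.submoduleOf, ← relativeLength_map,
      Submodule.map_comap_subtype, inf_eq_right.2 h']
  rw [hL]
  exact length_quotient_eq_add (Submodule.comap_mono h)

theorem relativeLength_sup_le (K J J' : Submodule A N) :
    relativeLength K (J ⊔ J') ≤ relativeLength K J + relativeLength K J' :=
  calc relativeLength K (J ⊔ J') = relativeLength K (J' ⊔ (J ⊔ K)) := by
        rw [← relativeLength_sup, sup_comm J, sup_assoc]
    _ = relativeLength K (J ⊔ K) + relativeLength (J ⊔ K) (J' ⊔ (J ⊔ K)) :=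
        relativeLength_eq_add le_sup_right le_sup_right
    _ ≤ relativeLength K J + relativeLength K J' := by
        rw [relativeLength_sup, relativeLength_sup]
        gcongr
        exact relativeLength_anti le_sup_right

theorem relativeLength_bot (J : Submodule A N) : relativeLength ⊥ J = Module.length A J := by
  rw [relativeLength_eq_length_map]
  exact (Submodule.equivMapOfInjective _ (LinearMap.ker_eq_bot.1 (Submodule.ker_mkQ _))
    J).length_eq.symm

end RelativeLength

section EventuallyPolynomial

/-- `f n` is finite and equal to `P n` for large `n`. Lengths are `ℕ∞`-valued, whence the witness
`k` instead of a cast of `f n`. -/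
def EventuallyEval (P : ℚ[X]) (f : ℕ → ℕ∞) : Prop :=
  ∀ᶠ n : ℕ in atTop, ∃ k : ℕ, f n = k ∧ P.eval (n : ℚ) = k

namespace EventuallyEval

variable {P Q : ℚ[X]} {f g : ℕ → ℕ∞}

theorem const (k : ℕ) : EventuallyEval (C (k : ℚ)) fun _ => k :=
  .of_forall fun _ => ⟨k, rfl, eval_C⟩

theorem pow (d : ℕ) : EventuallyEval (X ^ d) fun n => (n : ℕ∞) ^ d :=
  .of_forall fun n => ⟨n ^ d, by simp, by simp⟩

theorem add (hf : EventuallyEval P f) (hg : EventuallyEval Q g) :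
    EventuallyEval (P + Q) fun n => f n + g n := by
  filter_upwards [hf, hg] with n ⟨k, hk, hk'⟩ ⟨l, hl, hl'⟩
  exact ⟨k + l, by simp [hk, hl], by simp [hk', hl']⟩

theorem congr (hf : EventuallyEval P f) (h : ∀ᶠ n in atTop, f n = g n) : EventuallyEval P g := by
  filter_upwards [hf, h] with n ⟨k, hk, hk'⟩ h
  exact ⟨k, by rw [← h, hk], hk'⟩

theorem sum {ι : Type*} {P : ι → ℚ[X]} {f : ι → ℕ → ℕ∞} (s : Finset ι)
    (h : ∀ i ∈ s, EventuallyEval (P i) (f i)) :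
    EventuallyEval (∑ i ∈ s, P i) fun n => ∑ i ∈ s, f i n := by
  classical
  induction s using Finset.induction_on with
  | empty => simpa using const 0
  | insert a s ha ih =>
    simp only [Finset.sum_insert ha]
    exact (h a (Finset.mem_insert_self _ _)).add
      (ih fun i hi => h i (Finset.mem_insert_of_mem hi))

theorem of_shift (c : ℕ) (h : EventuallyEval P fun n => f (n + c)) :
    EventuallyEval (P.comp (X - C (c : ℚ))) f := by
  filter_upwards [(tendsto_sub_atTop_nat c).eventually h, eventually_ge_atTop c]
    with n ⟨k, hk, hk'⟩ hn
  refine ⟨k, by rwa [Nat.sub_add_cancel hn] at hk, ?_⟩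
  rw [← hk', eval_comp, Nat.cast_sub hn]
  simp

end EventuallyEval

theorem exists_eval_add_one_sub_eval (g : ℚ[X]) :
    ∃ S : ℚ[X], ∀ x : ℚ, S.eval (x + 1) - S.eval x = g.eval x := by
  induction g using Polynomial.induction_on' with
  | add p q hp hq =>
    obtain ⟨S, hS⟩ := hp
    obtain ⟨T, hT⟩ := hq
    refine ⟨S + T, fun x => ?_⟩
    rw [eval_add, eval_add, eval_add, ← hS, ← hT]
    ring
  | monomial n a =>
    refine ⟨C (a / (n + 1)) * Polynomial.bernoulli (n + 1), fun x => ?_⟩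
    have : (n : ℚ) + 1 ≠ 0 := by positivity
    rw [add_comm x 1, eval_mul, eval_mul, Polynomial.bernoulli_eval_one_add]
    simp only [eval_C, eval_monomial, Nat.add_sub_cancel, Nat.cast_add, Nat.cast_one]
    field_simp
    ring

theorem exists_eventuallyEval_of_add_eq {f a b : ℕ → ℕ∞} {P Q : ℚ[X]} (ha : EventuallyEval P a)
    (hb : EventuallyEval Q b) (hf : ∀ᶠ n in atTop, f n ≠ ⊤)
    (h : ∀ᶠ n in atTop, f (n + 1) + a n = f n + b n) : ∃ S, EventuallyEval S f := by
  obtain ⟨S, hS⟩ := exists_eval_add_one_sub_eval (Q - P)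
  obtain ⟨n₀, h₀⟩ := eventually_atTop.1 (ha.and (hb.and (hf.and h)))
  have hstep : ∀ n ≥ n₀, ((f (n + 1)).toNat : ℚ) - (f n).toNat =
      S.eval ((n : ℚ) + 1) - S.eval (n : ℚ) := by
    intro n hn
    obtain ⟨⟨k, hk, hk'⟩, ⟨l, hl, hl'⟩, hfn, hadd⟩ := h₀ n hn
    have hfn' := (h₀ (n + 1) (by lia)).2.2.1
    lift f n to ℕ using hfn with u
    lift f (n + 1) to ℕ using hfn' with v
    rw [hk, hl] at hadd
    rw [hS, eval_sub, hk', hl', ENat.toNat_natCast, ENat.toNat_natCast]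
    have : (v : ℚ) + k = u + l := by exact_mod_cast hadd
    linarith
  refine ⟨S + C ((f n₀).toNat - S.eval (n₀ : ℚ)), eventually_atTop.2 ⟨n₀, fun n hn =>
    ⟨(f n).toNat, (ENat.natCast_toNat (h₀ n hn).2.2.1).symm, ?_⟩⟩⟩
  induction n, hn using Nat.le_induction with
  | base => simp
  | succ n hn ih =>
    have := hstep n hn
    rw [eval_add, eval_C] at ih ⊢
    push_cast
    linarith

theorem exists_eventuallyEval_of_monotone {f : ℕ → ℕ∞} (h : Monotone f) (hb : ⨆ n, f n ≠ ⊤) :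
    ∃ k : ℕ, EventuallyEval (C (k : ℚ)) f := by
  obtain ⟨k, hk⟩ := ENat.ne_top_iff_exists.1 hb
  have hlim := tendsto_atTop_iSup h
  rw [← hk, ENat.nhds_natCast, tendsto_pure] at hlim
  exact ⟨k, (EventuallyEval.const k).congr (hlim.mono fun n hn => hn.symm)⟩

theorem norm_natCast_rat (n : ℕ) : ‖(n : ℚ)‖ = n := by
  rw [← Rat.norm_cast_real]
  simp

namespace EventuallyEval

variable {P Q : ℚ[X]} {f g : ℕ → ℕ∞}

theorem exists_eventually_le_mul (hf : EventuallyEval P f) (hg : EventuallyEval Q g)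
    (h : P.degree ≤ Q.degree) : ∃ c : ℕ, ∀ᶠ n in atTop, f n ≤ c * g n := by
  obtain ⟨c', hc'⟩ := (isBigO_atTop_of_degree_le _ _ h).bound
  obtain ⟨c, hc⟩ := exists_nat_ge c'
  refine ⟨c, ?_⟩
  filter_upwards [hf, hg, tendsto_natCast_atTop_atTop.eventually hc']
    with n ⟨k, hk, hk'⟩ ⟨l, hl, hl'⟩ hn
  rw [hk', hl', norm_natCast_rat, norm_natCast_rat] at hn
  have hkl : (k : ℝ) ≤ (c * l : ℕ) := by
    push_cast
    exact hn.trans (by gcongr)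
  rw [hk, hl]
  exact_mod_cast hkl

theorem degree_le (hf : EventuallyEval P f) (hg : EventuallyEval Q g)
    (h : ∀ᶠ n in atTop, f n ≤ g n) : P.degree ≤ Q.degree := by
  by_contra! hdeg
  have hP : P ≠ 0 := by
    rintro rfl
    simp at hdeg
  have hsmall := (isLittleO_atTop_of_degree_lt _ _ hdeg).def (show (0 : ℝ) < 1 / 2 by norm_num)
  obtain ⟨n, ⟨k, hk, hk'⟩, ⟨l, hl, hl'⟩, hfg, hhalf, hroot⟩ := (hf.and (hg.and (h.and
    (tendsto_natCast_atTop_atTop.eventually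
      (hsmall.and (eventually_atTop_not_isRoot P hP)))))).exists
  rw [hk', hl', norm_natCast_rat, norm_natCast_rat] at hhalf
  rw [hk, hl] at hfg
  have hkl : (k : ℝ) ≤ l := by exact_mod_cast hfg
  have hk0 : (k : ℝ) = 0 := le_antisymm (by linarith) k.cast_nonneg
  rw [IsRoot, hk'] at hroot
  exact hroot (by exact_mod_cast hk0)

theorem eventually_ne_zero (hf : EventuallyEval P f) (hP : P ≠ 0) : ∀ᶠ n in atTop, f n ≠ 0 := by
  filter_upwards [hf, tendsto_natCast_atTop_atTop.eventually (eventually_atTop_not_isRoot P hP)]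
    with n ⟨k, hk, hk'⟩ hroot
  rw [IsRoot, hk'] at hroot
  rw [hk]
  exact_mod_cast hroot

theorem ne_zero (hf : EventuallyEval P f) (h : ∀ᶠ n in atTop, f n ≠ 0) : P ≠ 0 := by
  rintro rfl
  obtain ⟨n, ⟨k, hk, hk'⟩, hn⟩ := (hf.and h).exists
  rw [eval_zero] at hk'
  rw [hk] at hn
  exact hn (by exact_mod_cast hk'.symm)

end EventuallyEval

end EventuallyPolynomial

section Growth

/-- `f n = O(n ^ d)`, with the constant valid for every `n`. The base is `n + 1` because `0 ^ d`
vanishes. -/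
def HasGrowthAtMost (d : ℕ) (f : ℕ → ℕ∞) : Prop :=
  ∃ c : ℕ, ∀ n : ℕ, f n ≤ c * (n + 1) ^ d

namespace HasGrowthAtMost

variable {d e : ℕ} {f g : ℕ → ℕ∞}

theorem mono (hg : HasGrowthAtMost d g) (h : ∀ n, f n ≤ g n) : HasGrowthAtMost d f :=
  let ⟨c, hc⟩ := hg
  ⟨c, fun n => (h n).trans (hc n)⟩

theorem mono_exponent (hf : HasGrowthAtMost d f) (h : d ≤ e) : HasGrowthAtMost e f := by
  obtain ⟨c, hc⟩ := hf
  refine ⟨c, fun n => (hc n).trans ?_⟩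
  gcongr
  exact le_add_self

theorem const (k : ℕ) : HasGrowthAtMost 0 fun _ => k :=
  ⟨k, fun _ => by simp⟩

theorem pow (d : ℕ) : HasGrowthAtMost d fun n => (n : ℕ∞) ^ d :=
  ⟨1, fun n => by rw [Nat.cast_one, one_mul]; exact pow_le_pow_left' le_self_add d⟩

theorem add (hf : HasGrowthAtMost d f) (hg : HasGrowthAtMost d g) :
    HasGrowthAtMost d fun n => f n + g n := by
  obtain ⟨a, ha⟩ := hf
  obtain ⟨b, hb⟩ := hg
  exact ⟨a + b, fun n => by push_cast; rw [add_mul]; exact add_le_add (ha n) (hb n)⟩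

theorem const_mul (k : ℕ) (hf : HasGrowthAtMost d f) : HasGrowthAtMost d fun n => k * f n := by
  obtain ⟨c, hc⟩ := hf
  exact ⟨k * c, fun n => by push_cast; rw [mul_assoc]; gcongr; exact hc n⟩

theorem sum_range (hf : HasGrowthAtMost d f) :
    HasGrowthAtMost (d + 1) fun n => ∑ k ∈ Finset.range n, f k := by
  obtain ⟨c, hc⟩ := hf
  refine ⟨c, fun n => ?_⟩
  calc ∑ k ∈ Finset.range n, f k
      ≤ (Finset.range n).card • (c * ((n : ℕ∞) + 1) ^ d) :=
        Finset.sum_le_card_nsmul _ _ _ fun k hk => (hc k).trans (by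
          have := (Finset.mem_range.1 hk).le
          gcongr)
    _ ≤ (n + 1) * (c * ((n : ℕ∞) + 1) ^ d) := by
        rw [Finset.card_range, nsmul_eq_mul]
        gcongr
        exact le_self_add
    _ = c * ((n : ℕ∞) + 1) ^ (d + 1) := by ring

theorem of_eventually_le (hg : HasGrowthAtMost d g) (hf : ∀ n, f n ≠ ⊤)
    (h : ∀ᶠ n in atTop, f n ≤ g n) : HasGrowthAtMost d f := by
  obtain ⟨n₀, hn₀⟩ := eventually_atTop.1 h
  obtain ⟨b, hb⟩ := ENat.ne_top_iff_exists.1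
    (show ∑ k ∈ Finset.range n₀, f k ≠ ⊤ from WithTop.sum_ne_top.2 fun k _ => hf k)
  refine ((const b).mono_exponent d.zero_le |>.add hg).mono fun n => ?_
  rcases lt_or_ge n n₀ with hn | hn
  · rw [hb]
    exact (Finset.single_le_sum (fun _ _ => zero_le) (Finset.mem_range.2 hn)).trans le_self_add
  · exact (hn₀ n hn).trans le_add_self

theorem sum_range_of_comp_add {c : ℕ} (hf : ∀ n, f n ≠ ⊤)
    (h : HasGrowthAtMost d fun n => ∑ k ∈ Finset.range n, f (k + c)) :
    HasGrowthAtMost d fun n => ∑ k ∈ Finset.range n, f k := by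
  obtain ⟨b, hb⟩ := ENat.ne_top_iff_exists.1
    (show ∑ k ∈ Finset.range c, f k ≠ ⊤ from WithTop.sum_ne_top.2 fun k _ => hf k)
  refine ((const b).mono_exponent d.zero_le |>.add h).mono fun n => ?_
  calc ∑ k ∈ Finset.range n, f k ≤ ∑ k ∈ Finset.range (c + n), f k :=
        Finset.sum_le_sum_of_subset (Finset.range_subset_range.2 (Nat.le_add_left n c))
    _ = b + ∑ k ∈ Finset.range n, f (k + c) := by
        rw [Finset.sum_range_add, ← hb]
        simp only [add_comm c]

theorem comp_add (hf : HasGrowthAtMost d f) (c : ℕ) : HasGrowthAtMost d fun n => f (n + c) := by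
  obtain ⟨b, hb⟩ := hf
  refine ⟨b * (c + 1) ^ d, fun n => (hb (n + c)).trans ?_⟩
  have : b * (n + c + 1) ^ d ≤ b * (c + 1) ^ d * (n + 1) ^ d := by
    rw [mul_assoc, ← mul_pow]
    gcongr
    nlinarith
  exact_mod_cast this

theorem succ_mul_of_add_le (hf : HasGrowthAtMost d f) (hg : Monotone g) {c : ℕ}
    (h : ∀ n, f n + g (n + c) ≤ f (n + c)) : HasGrowthAtMost d fun n => (n + 1) * g n := by
  obtain ⟨b, hb⟩ := hf
  have hmul : ∀ n j : ℕ, j * g n ≤ f (n + j * c) := by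
    intro n j
    induction j with
    | zero => simp
    | succ j ih =>
      calc ((j + 1 : ℕ) : ℕ∞) * g n = j * g n + g n := by push_cast; ring
        _ ≤ f (n + j * c) + g (n + j * c + c) := add_le_add ih (hg (by lia))
        _ ≤ f (n + j * c + c) := h _
        _ = f (n + (j + 1) * c) := by rw [add_one_mul, add_assoc]
  refine ⟨b * (c + 1) ^ d, fun n => ?_⟩
  calc ((n : ℕ∞) + 1) * g n = (n + 1 : ℕ) * g n := by push_cast; rfl
    _ ≤ b * ((n + (n + 1) * c : ℕ) + 1) ^ d := (hmul n (n + 1)).trans (hb _)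
    _ = (b * (c + 1) ^ d : ℕ) * (n + 1) ^ d := by
        push_cast
        rw [mul_assoc, ← mul_pow]
        congr 2
        ring

theorem of_succ_mul (h : HasGrowthAtMost (d + 1) fun n => (n + 1) * g n) :
    HasGrowthAtMost d g := by
  obtain ⟨b, hb⟩ := h
  refine ⟨b, fun n => (ENat.mul_le_mul_left_iff (a := n + 1) (by simp) ?_).1 ?_⟩
  · exact_mod_cast ENat.natCast_ne_top (n + 1)
  · calc ((n : ℕ∞) + 1) * g n ≤ b * (n + 1) ^ (d + 1) := hb n
      _ = (n + 1) * (b * (n + 1) ^ d) := by ring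

theorem exists_eq_zero (h : HasGrowthAtMost 0 fun n => (n + 1) * g n) : ∃ n ≠ 0, g n = 0 := by
  obtain ⟨b, hb⟩ := h
  refine ⟨b + 1, by lia, ?_⟩
  by_contra hg
  have hle : ((b + 1 : ℕ) : ℕ∞) + 1 ≤ b :=
    (le_mul_of_one_le_right zero_le (Order.one_le_iff_ne_zero.2 hg)).trans
      ((hb (b + 1)).trans_eq (by simp))
  have : b + 1 + 1 ≤ b := by exact_mod_cast hle
  lia

end HasGrowthAtMost

variable {P : ℚ[X]} {f : ℕ → ℕ∞}

theorem EventuallyEval.hasGrowthAtMost_natDegree (h : EventuallyEval P f) (hf : ∀ n, f n ≠ ⊤) :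
    HasGrowthAtMost P.natDegree f := by
  obtain ⟨c, hc⟩ := h.exists_eventually_le_mul (pow P.natDegree)
    (by rw [degree_X_pow]; exact degree_le_natDegree)
  exact ((HasGrowthAtMost.pow P.natDegree).const_mul c).of_eventually_le hf hc

theorem pow_succ_le_mul_sum_range {L c n₀ : ℕ} (h : ∀ n ≥ n₀, (n : ℕ∞) ^ L ≤ c * f n) {n : ℕ}
    (hn : n₀ ≤ n) : (n : ℕ∞) ^ (L + 1) ≤ c * ∑ k ∈ Finset.range (2 * n), f k :=
  calc (n : ℕ∞) ^ (L + 1) = ∑ _k ∈ Finset.Ico n (2 * n), (n : ℕ∞) ^ L := by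
        rw [Finset.sum_const, Nat.card_Ico, two_mul, Nat.add_sub_cancel, nsmul_eq_mul, pow_succ']
    _ ≤ ∑ k ∈ Finset.Ico n (2 * n), c * f k := Finset.sum_le_sum fun k hk => by
        have hk := (Finset.mem_Ico.1 hk).1
        refine le_trans ?_ (h k (hn.trans hk))
        gcongr
    _ ≤ ∑ k ∈ Finset.range (2 * n), c * f k := Finset.sum_le_sum_of_subset fun k hk =>
        Finset.mem_range.2 (Finset.mem_Ico.1 hk).2
    _ = c * ∑ k ∈ Finset.range (2 * n), f k := (Finset.mul_sum ..).symm

theorem EventuallyEval.degree_lt_of_hasGrowthAtMost_sum_range (h : EventuallyEval P f) {L : ℕ}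
    (hs : HasGrowthAtMost L fun n => ∑ k ∈ Finset.range n, f k) : P.degree < L := by
  by_contra! hdeg
  obtain ⟨c, hc⟩ := (pow L).exists_eventually_le_mul h (by rwa [degree_X_pow])
  obtain ⟨n₀, hn₀⟩ := eventually_atTop.1 hc
  obtain ⟨b, hb⟩ := hs
  have hbound : ∀ n ≥ n₀, n ≠ 0 → n ≤ c * b * 3 ^ L := by
    intro n hn hn'
    have hpow : n ^ (L + 1) ≤ c * (b * (2 * n + 1) ^ L) := by
      have := (pow_succ_le_mul_sum_range hn₀ hn).trans (mul_le_mul_right (hb (2 * n)) _)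
      exact_mod_cast this
    refine Nat.le_of_mul_le_mul_right (c := n ^ L) ?_ (by positivity)
    calc n * n ^ L ≤ c * (b * (2 * n + 1) ^ L) := by rwa [← pow_succ']
      _ ≤ c * (b * (3 * n) ^ L) := by gcongr; lia
      _ = c * b * 3 ^ L * n ^ L := by ring
  have := hbound (n₀ + c * b * 3 ^ L + 1) (by lia) (by lia)
  lia

end Growth

section HilbertFunction

variable {A : Type*} [CommRing A] {N : Type*} [AddCommGroup N] [Module A N] {I : Ideal A}

/-- The graded module `⨁ Jₙ/Kₙ` is Noetherian over the polynomial ring with variables `S`. This is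
encoded without graded modules: a graded submodule is a filtration `L` between `K` and `J`, and it
is to be generated by `S` in high degrees. -/
def NoetherianPair (S : Finset A) (J K : I.Filtration N) : Prop :=
  ∀ L : I.Filtration N, K ≤ L → L ≤ J →
    ∀ᶠ n in atTop, L.N (n + 1) ≤ Ideal.span (S : Set A) • L.N n ⊔ K.N (n + 1)

/-- The kernel of multiplication by `x : Jₙ/Kₙ → Jₙ₊₁/Kₙ₊₁`. -/
def kernelFiltration (x : A) (J K : I.Filtration N) : I.Filtration N where
  N n := J.N n ⊓ (K.N (n + 1)).comap (LinearMap.lsmul A N x)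
  mono n := inf_le_inf (J.mono n) (Submodule.comap_mono (K.mono _))
  smul_le n := by
    rw [Submodule.smul_le]
    rintro a ha y ⟨hy, hy'⟩
    refine ⟨J.smul_le n (Submodule.smul_mem_smul ha hy), ?_⟩
    simp only [SetLike.mem_coe, Submodule.mem_comap, LinearMap.lsmul_apply] at hy' ⊢
    rw [smul_comm]
    exact K.smul_le _ (Submodule.smul_mem_smul ha hy')

/-- The image of `x : Jₙ → Jₙ₊₁/Kₙ₊₁`, as a submodule of `Jₙ₊₁` containing `Kₙ₊₁`. -/
def imageFiltration (x : A) (J K : I.Filtration N) : I.Filtration N where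
  N n := (J.N n).map (LinearMap.lsmul A N x) ⊔ K.N (n + 1)
  mono n := sup_le_sup (Submodule.map_mono (J.mono _)) (K.mono _)
  smul_le n := by
    rw [Submodule.smul_sup, ← Submodule.map_smul'']
    exact sup_le_sup (Submodule.map_mono (J.smul_le _)) (K.smul_le _)

/-- The filtration `J_c, J_{c+1}, …`. -/
def shiftFiltration (c : ℕ) (J : I.Filtration N) : I.Filtration N where
  N n := J.N (n + c)
  mono n := by
    rw [add_right_comm]
    exact J.mono _
  smul_le n := by
    rw [add_right_comm]
    exact J.smul_le _

/-- The filtration `J, L₀, L₁, …`, whose shift by one is `L`. -/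
def consFiltration (J : Submodule A N) (L : I.Filtration N) (hL : L.N 0 ≤ J)
    (hJ : I • J ≤ L.N 0) : I.Filtration N where
  N n := n.casesOn J L.N
  mono n := by
    cases n with
    | zero => exact hL
    | succ n => exact L.mono n
  smul_le n := by
    cases n with
    | zero => exact hJ
    | succ n => exact L.smul_le n

variable {x : A} {J K L : I.Filtration N}

theorem map_lsmul_le (hx : x ∈ I) (n : ℕ) :
    (J.N n).map (LinearMap.lsmul A N x) ≤ J.N (n + 1) :=
  Submodule.map_le_iff_le_comap.2 fun _ hy => J.smul_le n (Submodule.smul_mem_smul hx hy)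

theorem le_kernelFiltration (hx : x ∈ I) (hKJ : K ≤ J) : K ≤ kernelFiltration x J K :=
  fun n => le_inf (hKJ n) (Submodule.map_le_iff_le_comap.1 (map_lsmul_le hx n))

theorem kernelFiltration_le : kernelFiltration x J K ≤ J :=
  fun _ => inf_le_left

theorem imageFiltration_le_shift (hx : x ∈ I) (hKJ : K ≤ J) :
    imageFiltration x J K ≤ shiftFiltration 1 J :=
  fun n => sup_le (map_lsmul_le hx n) (hKJ _)

theorem span_insert_smul [DecidableEq A] (x : A) (S : Finset A) (L : Submodule A N) :
    Ideal.span ((insert x S : Finset A) : Set A) • L =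
      L.map (LinearMap.lsmul A N x) ⊔ Ideal.span (S : Set A) • L := by
  rw [Finset.coe_insert, Ideal.span_insert, Submodule.sup_smul,
    Submodule.ideal_span_singleton_smul]
  rfl

theorem NoetherianPair.kernel [DecidableEq A] {S : Finset A}
    (h : NoetherianPair (insert x S) J K) : NoetherianPair S (kernelFiltration x J K) K := by
  intro L hKL hL
  filter_upwards [h L hKL (hL.trans kernelFiltration_le)] with n hn
  have hxL : (L.N n).map (LinearMap.lsmul A N x) ≤ K.N (n + 1) :=
    Submodule.map_le_iff_le_comap.2 ((hL n).trans inf_le_right)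
  refine hn.trans ?_
  rw [span_insert_smul]
  exact sup_le (sup_le (hxL.trans le_sup_right) le_sup_left) le_sup_right

theorem NoetherianPair.image [DecidableEq A] {S : Finset A} (hKJ : K ≤ J)
    (h : NoetherianPair (insert x S) J K) :
    NoetherianPair S (shiftFiltration 1 J) (imageFiltration x J K) := by
  intro L hL hLJ
  have hKL : ∀ n, K.N (n + 1) ≤ L.N n := fun n => le_sup_right.trans (hL n)
  let L' : I.Filtration N := consFiltration (K.N 0 ⊔ L.N 0) L le_sup_right (by
    rw [Submodule.smul_sup]
    exact sup_le ((K.smul_le 0).trans (hKL 0)) ((L.smul_le 0).trans (L.mono 0)))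
  have hKL' : K ≤ L' := by
    rintro (_ | n)
    exacts [le_sup_left, hKL n]
  have hLJ' : L' ≤ J := by
    rintro (_ | n)
    exacts [sup_le (hKJ 0) ((hLJ 0).trans (J.mono 0)), hLJ n]
  filter_upwards [(tendsto_add_atTop_nat 1).eventually (h L' hKL' hLJ')] with n hn
  have hxL : (L.N n).map (LinearMap.lsmul A N x) ≤ (imageFiltration x J K).N (n + 1) :=
    (Submodule.map_mono (hLJ n)).trans le_sup_left
  refine hn.trans ?_
  rw [span_insert_smul]
  exact sup_le (sup_le (hxL.trans le_sup_right) le_sup_left) (le_sup_right.trans le_sup_right)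

theorem relativeLength_eq_kernelFiltration_add (hx : x ∈ I) (hKJ : K ≤ J) (n : ℕ) :
    relativeLength (K.N n) (J.N n) = relativeLength (K.N n) ((kernelFiltration x J K).N n) +
      relativeLength ((kernelFiltration x J K).N n) (J.N n) :=
  relativeLength_eq_add (le_kernelFiltration hx hKJ n) inf_le_left

theorem relativeLength_succ_eq_kernelFiltration_add (hx : x ∈ I) (hKJ : K ≤ J) (n : ℕ) :
    relativeLength (K.N (n + 1)) (J.N (n + 1)) =
      relativeLength ((kernelFiltration x J K).N n) (J.N n) +
        relativeLength ((imageFiltration x J K).N n) ((shiftFiltration 1 J).N n) := by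
  have himage : relativeLength (K.N (n + 1)) ((imageFiltration x J K).N n) =
      relativeLength ((kernelFiltration x J K).N n) (J.N n) := by
    rw [kernelFiltration, imageFiltration, relativeLength_sup, relativeLength_map,
      relativeLength_inf_left]
  rw [← himage]
  exact relativeLength_eq_add le_sup_right (imageFiltration_le_shift hx hKJ n)

theorem NoetherianPair.exists_eventuallyEval {S : Finset A} (hS : ∀ x ∈ S, x ∈ I)
    (h : NoetherianPair S J K) (hKJ : K ≤ J) (hfin : ∀ n, relativeLength (K.N n) (J.N n) ≠ ⊤) :
    ∃ P : ℚ[X], EventuallyEval P fun n => relativeLength (K.N n) (J.N n) := by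
  classical
  induction S using Finset.induction_on generalizing J K with
  | empty =>
    have hJK : ∀ᶠ n in atTop, J.N (n + 1) ≤ K.N (n + 1) := by simpa using h J hKJ le_rfl
    refine ⟨_, (EventuallyEval.const 0).congr ?_⟩
    filter_upwards [(tendsto_sub_atTop_nat 1).eventually hJK, eventually_ge_atTop 1] with n hn hn'
    rw [Nat.sub_add_cancel hn'] at hn
    rw [relativeLength_eq_zero_iff.2 hn, Nat.cast_zero]
  | insert x S _ ih =>
    have hx : x ∈ I := hS x (Finset.mem_insert_self _ _)
    have hadd := relativeLength_eq_kernelFiltration_add hx hKJ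
    have hadd' := relativeLength_succ_eq_kernelFiltration_add hx hKJ
    have hS' : ∀ y ∈ S, y ∈ I := fun y hy => hS y (Finset.mem_insert_of_mem hy)
    obtain ⟨P, hP⟩ := ih hS' h.kernel (le_kernelFiltration hx hKJ) fun n =>
      ne_top_of_le_ne_top (hfin n) (hadd n ▸ le_self_add)
    obtain ⟨Q, hQ⟩ := ih hS' (h.image hKJ) (imageFiltration_le_shift hx hKJ) fun n =>
      ne_top_of_le_ne_top (hfin (n + 1)) (hadd' n ▸ le_add_self)
    refine exists_eventuallyEval_of_add_eq hP hQ (.of_forall hfin) (.of_forall fun n => ?_)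
    rw [hadd', hadd n]
    ring

theorem exists_noetherianPair [IsNoetherianRing A] [Module.Finite A N] (hJ : J.Stable) :
    ∃ S : Finset A, (∀ x ∈ S, x ∈ I) ∧ ∀ K, NoetherianPair S J K := by
  obtain ⟨S, hS⟩ := IsNoetherian.noetherian I
  refine ⟨S, fun x hx => hS ▸ Submodule.subset_span hx, fun K L _ hL => ?_⟩
  obtain ⟨n₀, h⟩ := hJ.of_le hL
  filter_upwards [eventually_ge_atTop n₀] with n hn
  rw [← h n hn, Ideal.span, hS]
  exact le_sup_left

theorem exists_eventuallyEval_relativeLength [IsNoetherianRing A] [Module.Finite A N]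
    (hJ : J.Stable) (hKJ : K ≤ J) (h : ∀ n, relativeLength (K.N n) (J.N n) ≠ ⊤) :
    ∃ P : ℚ[X], EventuallyEval P fun n => relativeLength (K.N n) (J.N n) := by
  obtain ⟨S, hS, hS'⟩ := exists_noetherianPair hJ
  exact (hS' K).exists_eventuallyEval hS hKJ h

end HilbertFunction

section Colon

variable {A : Type*} [CommRing A] {N : Type*} [AddCommGroup N] [Module A N]

/-- The submodule `K :_N 𝔞` of the elements of `N` that `𝔞` multiplies into `K`. For maximal `𝔞`
it is the preimage of the socle of `N ⧸ K` at `𝔞`. -/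
def moduleColon (K : Submodule A N) (𝔞 : Ideal A) : Submodule A N :=
  (Submodule.torsionBySet A (N ⧸ K) 𝔞).comap K.mkQ

variable {K : Submodule A N} {𝔞 : Ideal A} {x : N}

theorem mem_moduleColon : x ∈ moduleColon K 𝔞 ↔ ∀ a ∈ 𝔞, a • x ∈ K := by
  simp [moduleColon, Submodule.mem_torsionBySet_iff, ← Submodule.Quotient.mk_smul,
    Submodule.Quotient.mk_eq_zero]

theorem mem_moduleColon_span {s : Set A} :
    x ∈ moduleColon K (Ideal.span s) ↔ ∀ a ∈ s, a • x ∈ K := by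
  rw [moduleColon, ← Submodule.torsionBySet_eq_torsionBySet_span]
  simp [Submodule.mem_torsionBySet_iff, ← Submodule.Quotient.mk_smul,
    Submodule.Quotient.mk_eq_zero]

theorem le_moduleColon (K : Submodule A N) (𝔞 : Ideal A) : K ≤ moduleColon K 𝔞 :=
  fun _ hx => mem_moduleColon.2 fun a _ => K.smul_mem a hx

theorem smul_moduleColon_le (K : Submodule A N) (𝔞 : Ideal A) : 𝔞 • moduleColon K 𝔞 ≤ K :=
  Submodule.smul_le.2 fun a ha _ hx => mem_moduleColon.1 hx a ha

theorem comap_pi_lsmul (K : Submodule A N) (s : Finset A) :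
    (Submodule.pi Set.univ fun _ : s => K).comap
        (LinearMap.pi fun a : s => LinearMap.lsmul A N (a : A)) =
      moduleColon K (Ideal.span (s : Set A)) := by
  ext x
  simp [mem_moduleColon_span]

theorem smul_top_pi {ι : Type*} [Finite ι] (I : Ideal A) :
    I • (⊤ : Submodule A (ι → N)) = Submodule.pi Set.univ fun _ => I • (⊤ : Submodule A N) := by
  classical
  have := Fintype.ofFinite ι
  refine le_antisymm (Submodule.smul_le.2 fun a ha y _ i _ =>
    Submodule.smul_mem_smul ha trivial) fun x hx => ?_
  have hsingle (i : ι) : I • (⊤ : Submodule A N) ≤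
      (I • (⊤ : Submodule A (ι → N))).comap (LinearMap.single A (fun _ => N) i) :=
    Submodule.smul_le.2 fun a ha y _ => by
      rw [Submodule.mem_comap, map_smul]
      exact Submodule.smul_mem_smul ha trivial
  rw [← Finset.univ_sum_single x]
  exact Submodule.sum_mem _ fun i _ => hsingle i (hx i trivial)

theorem exists_moduleColon_pow_eq [IsNoetherianRing A] [Module.Finite A N] (𝔞 I : Ideal A) :
    ∃ c : ℕ, ∀ n, moduleColon (I ^ (n + c) • ⊤ : Submodule A N) 𝔞 =
      I ^ n • moduleColon (I ^ c • ⊤ : Submodule A N) 𝔞 ⊔ moduleColon ⊥ 𝔞 := by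
  obtain ⟨s, rfl⟩ := IsNoetherian.noetherian 𝔞
  let φ : N →ₗ[A] (s → N) := LinearMap.pi fun a => LinearMap.lsmul A N a
  have hφ (n : ℕ) : (I ^ n • ⊤ ⊓ LinearMap.range φ).comap φ =
      moduleColon (I ^ n • ⊤) (Ideal.span (s : Set A)) := by
    rw [Submodule.comap_inf, smul_top_pi, comap_pi_lsmul]
    exact inf_eq_left.2 fun x _ => ⟨x, rfl⟩
  have hker : LinearMap.ker φ = moduleColon ⊥ (Ideal.span (s : Set A)) := by
    ext x
    simp [φ, ← comap_pi_lsmul, funext_iff]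
  obtain ⟨c, hc⟩ := I.exists_pow_inf_eq_pow_smul (LinearMap.range φ)
  refine ⟨c, fun n => ?_⟩
  have h := hc (n + c) (by lia)
  rw [Nat.add_sub_cancel, ← Submodule.map_comap_eq_self (q := I ^ c • ⊤ ⊓ LinearMap.range φ)
    (f := φ) inf_le_right, ← Submodule.map_smul''] at h
  rw [← hφ, h, Submodule.comap_map_eq, hφ, hker]

end Colon

section LengthBounds

variable {A : Type*} [CommRing A] {N : Type*} [AddCommGroup N] [Module A N]

theorem relativeLength_pi {ι : Type*} [Fintype ι] {N : ι → Type*} [∀ i, AddCommGroup (N i)]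
    [∀ i, Module A (N i)] (K J : ∀ i, Submodule A (N i)) :
    relativeLength (Submodule.pi Set.univ K) (Submodule.pi Set.univ J) =
      ∑ i, relativeLength (K i) (J i) := by
  classical
  let f : (∀ i, J i) →ₗ[A] ∀ i, N i := LinearMap.pi fun i => (J i).subtype ∘ₗ LinearMap.proj i
  have hrange : (⊤ : Submodule A (∀ i, J i)).map f = Submodule.pi Set.univ J := by
    ext x
    simp only [Submodule.map_top, LinearMap.mem_range, Submodule.mem_pi, Set.mem_univ,
      forall_const]
    exact ⟨fun ⟨y, hy⟩ i => hy ▸ (y i).2, fun hx => ⟨fun i => ⟨x i, hx i⟩, rfl⟩⟩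
  have hcomap : (Submodule.pi Set.univ K).comap f =
      Submodule.pi Set.univ fun i => (K i).submoduleOf (J i) := by
    ext x
    simp [f, Submodule.submoduleOf]
  rw [← hrange, relativeLength_map, hcomap, relativeLength_top,
    (Submodule.quotientPi _).length_eq, Module.length_pi_of_fintype]
  rfl

theorem relativeLength_le_card_mul {𝔞 : Ideal A} {K J : Submodule A N} {ι : Type*} [Fintype ι]
    (u : ι → N) (hu : J ≤ Submodule.span A (Set.range u) ⊔ K) (h : ∀ a ∈ 𝔞, ∀ i, a • u i ∈ K) :
    relativeLength K J ≤ Fintype.card ι * Module.length A (A ⧸ 𝔞) := by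
  let f : (ι → A) →ₗ[A] N := Fintype.linearCombination A u
  have hf : Submodule.pi Set.univ (fun _ => 𝔞) ≤ K.comap f := fun x hx =>
    K.sum_mem fun i _ => h _ (hx i trivial) i
  calc relativeLength K J ≤ relativeLength K (Submodule.span A (Set.range u) ⊔ K) :=
        relativeLength_mono hu
    _ = relativeLength (K.comap f) ⊤ := by
        rw [relativeLength_sup, ← relativeLength_map, Submodule.map_top,
          Fintype.range_linearCombination]
    _ ≤ relativeLength (Submodule.pi Set.univ fun _ => 𝔞) (Submodule.pi Set.univ fun _ => ⊤) := by
        rw [Submodule.pi_top]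
        exact relativeLength_anti hf
    _ = Fintype.card ι * Module.length A (A ⧸ 𝔞) := by
        rw [relativeLength_pi]
        simp [relativeLength_top]

theorem relativeLength_moduleColon_span_le (s : Finset A) {K J J' : Submodule A N}
    (h : ∀ a ∈ s, ∀ x ∈ J, a • x ∈ J') :
    relativeLength (moduleColon K (Ideal.span (s : Set A))) J ≤ s.card * relativeLength K J' := by
  rw [← comap_pi_lsmul, ← relativeLength_map]
  calc _ ≤ relativeLength (Submodule.pi Set.univ fun _ : s => K)
        (Submodule.pi Set.univ fun _ : s => J') :=
        relativeLength_mono (Submodule.map_le_iff_le_comap.2 fun x hx a _ => h a a.2 x hx)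
    _ = s.card * relativeLength K J' := by simp [relativeLength_pi]

end LengthBounds

section LocalLength

variable {A : Type*} [CommRing A] [IsLocalRing A] {N : Type*} [AddCommGroup N] [Module A N]

theorem length_quotient_maximalIdeal : Module.length A (A ⧸ maximalIdeal A) = 1 := by
  rw [Module.length_eq_one_iff]
  exact isSimpleModule_iff_isCoatom.2 (Ideal.isMaximal_def.1 inferInstance)

theorem relativeLength_ne_top_of_smul_le [IsNoetherian A N] {K J : Submodule A N}
    (h : maximalIdeal A • J ≤ K) : relativeLength K J ≠ ⊤ := by
  obtain ⟨s, hs⟩ := IsNoetherian.noetherian J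
  have hle := relativeLength_le_card_mul (𝔞 := maximalIdeal A) (K := K) (J := J)
    (fun i : s => (i : N)) (by simp [hs]) fun a ha i => h (Submodule.smul_mem_smul ha
      (hs ▸ Submodule.subset_span i.2))
  rw [length_quotient_maximalIdeal, mul_one] at hle
  exact ne_top_of_le_ne_top (ENat.natCast_ne_top _) hle

theorem relativeLength_ne_top_of_pow_smul_le [IsNoetherian A N] {K J : Submodule A N} (s : ℕ)
    (h : maximalIdeal A ^ s • J ≤ K) : relativeLength K J ≠ ⊤ := by
  induction s generalizing J with
  | zero =>
    rw [pow_zero, Ideal.one_eq_top, Submodule.top_smul] at h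
    rw [relativeLength_eq_zero_iff.2 h]
    exact ENat.zero_ne_top
  | succ s ih =>
    rw [← relativeLength_sup, relativeLength_eq_add (L := maximalIdeal A • J ⊔ K) le_sup_right
      (sup_le_sup_right Submodule.smul_le_right _), relativeLength_sup]
    refine WithTop.add_ne_top.2 ⟨ih ?_, relativeLength_ne_top_of_smul_le ?_⟩
    · rwa [← Submodule.mul_smul, ← pow_succ]
    · rw [Submodule.smul_sup]
      exact sup_le_sup_left Submodule.smul_le_right _

theorem length_quotient_pow_maximalIdeal_ne_top [IsNoetherianRing A] (s : ℕ) :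
    Module.length A (A ⧸ maximalIdeal A ^ s) ≠ ⊤ := by
  rw [← relativeLength_top]
  exact relativeLength_ne_top_of_pow_smul_le s (by rw [smul_eq_mul]; exact Ideal.mul_le_left)

theorem exists_relativeLength_le_mul_socle [IsNoetherianRing A] (s : ℕ) :
    ∃ c : ℕ, ∀ K J : Submodule A N, K ≤ J → maximalIdeal A ^ s • J ≤ K →
      relativeLength K J ≤ c * relativeLength K (moduleColon K (maximalIdeal A)) := by
  induction s with
  | zero =>
    refine ⟨0, fun K J _ h => ?_⟩
    rw [pow_zero, Ideal.one_eq_top, Submodule.top_smul] at h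
    simp [relativeLength_eq_zero_iff.2 h]
  | succ s ih =>
    obtain ⟨c, hc⟩ := ih
    obtain ⟨t, ht⟩ := IsNoetherian.noetherian (maximalIdeal A ^ s)
    refine ⟨c + t.card, fun K J hKJ h => ?_⟩
    have hKJ' : K ≤ J ⊓ moduleColon K (maximalIdeal A ^ s) := le_inf hKJ (le_moduleColon _ _)
    have hlow := hc K _ hKJ' ((smul_mono_right _ inf_le_right).trans (smul_moduleColon_le _ _))
    have hhigh : relativeLength (J ⊓ moduleColon K (maximalIdeal A ^ s)) J ≤
        t.card * relativeLength K (moduleColon K (maximalIdeal A)) := by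
      rw [relativeLength_inf_left, ← ht]
      refine relativeLength_moduleColon_span_le t fun a ha x hx => mem_moduleColon.2 fun b hb => ?_
      rw [smul_smul]
      refine h (Submodule.smul_mem_smul ?_ hx)
      rw [pow_succ']
      exact Ideal.mul_mem_mul hb (ht ▸ Submodule.subset_span ha)
    rw [relativeLength_eq_add hKJ' inf_le_left, Nat.cast_add, add_mul]
    exact add_le_add hlow hhigh

end LocalLength

section SoclePolynomial

variable {A : Type*} [CommRing A] [IsLocalRing A] [IsNoetherianRing A] {N : Type*}
  [AddCommGroup N] [Module A N] [Module.Finite A N]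

theorem exists_relativeLength_socle_eq_add (I : Ideal A) :
    ∃ (c : ℕ) (D : Submodule A N), (∀ n, I ^ (n + c) • ⊤ ≤ I ^ n • D) ∧
      (∀ n, maximalIdeal A • I ^ n • D ≤ I ^ (n + c) • ⊤) ∧
      ∀ n, relativeLength (I ^ (n + c) • ⊤ : Submodule A N)
          (moduleColon (I ^ (n + c) • ⊤) (maximalIdeal A)) =
        relativeLength (I ^ (n + c) • ⊤) (I ^ n • D) +
          relativeLength (I ^ n • D) (moduleColon ⊥ (maximalIdeal A)) := by
  obtain ⟨c, hc⟩ := exists_moduleColon_pow_eq (N := N) (maximalIdeal A) I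
  have hle (n : ℕ) : (I ^ (n + c) • ⊤ : Submodule A N) ≤
      I ^ n • moduleColon (I ^ c • ⊤) (maximalIdeal A) := by
    rw [pow_add, Submodule.mul_smul]
    exact smul_mono_right _ (le_moduleColon _ _)
  refine ⟨c, moduleColon (I ^ c • ⊤) (maximalIdeal A), hle, fun n => ?_, fun n => ?_⟩
  · rw [← Submodule.mul_smul, mul_comm, Submodule.mul_smul, pow_add, Submodule.mul_smul]
    exact smul_mono_right _ (smul_moduleColon_le _ _)
  · rw [hc, relativeLength_eq_add (hle n) le_sup_left, sup_comm, relativeLength_sup]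

theorem exists_eventuallyEval_socle (I : Ideal A) :
    ∃ P : ℚ[X], EventuallyEval P fun n =>
      relativeLength (I ^ n • ⊤ : Submodule A N) (moduleColon (I ^ n • ⊤) (maximalIdeal A)) := by
  obtain ⟨c, D, hle, hsmul, hsum⟩ := exists_relativeLength_socle_eq_add (N := N) I
  have hmono : Monotone fun n => relativeLength (I ^ n • D) (moduleColon ⊥ (maximalIdeal A)) :=
    fun k l hkl => relativeLength_anti (Submodule.smul_mono_left (Ideal.pow_le_pow_right hkl))
  obtain ⟨k, hk⟩ := exists_eventuallyEval_of_monotone hmono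
    (ne_top_of_le_ne_top (relativeLength_ne_top_of_smul_le (smul_moduleColon_le ⊥ _))
      (iSup_le fun n => relativeLength_anti bot_le))
  obtain ⟨P, hP⟩ := exists_eventuallyEval_relativeLength
    (K := shiftFiltration c (I.stableFiltration ⊤)) (I.stableFiltration_stable D) hle
    fun n => relativeLength_ne_top_of_smul_le (hsmul n)
  exact ⟨_, .of_shift c ((hP.add hk).congr (.of_forall fun n => (hsum n).symm))⟩

theorem exists_relativeLength_socle_le_add (I : Ideal A) :
    ∃ (c b : ℕ) (D : Submodule A N), (∀ n, maximalIdeal A • I ^ n • D ≤ I ^ (n + c) • ⊤) ∧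
      ∀ n, relativeLength (I ^ (n + c) • ⊤ : Submodule A N)
          (moduleColon (I ^ (n + c) • ⊤) (maximalIdeal A)) ≤
        relativeLength (I ^ (n + c) • ⊤) (I ^ n • D) + b := by
  obtain ⟨c, D, -, hsmul, hsum⟩ := exists_relativeLength_socle_eq_add (N := N) I
  obtain ⟨b, hb⟩ := ENat.ne_top_iff_exists.1
    (relativeLength_ne_top_of_smul_le (smul_moduleColon_le (⊥ : Submodule A N) (maximalIdeal A)))
  refine ⟨c, b, D, hsmul, fun n => ?_⟩
  rw [hsum, hb]
  gcongr
  exact relativeLength_anti bot_le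

end SoclePolynomial

section GradedArtinRees

section ArtinRees

variable {S P : Type*} [CommRing S] [IsNoetherianRing S] [AddCommGroup P] [Module S P]
  (m : Ideal S) {E H K : Submodule S P}

theorem exists_inf_pow_smul_top_eq_bot [Module.Finite S P] (h : m • H = ⊥) :
    ∃ s, H ⊓ m ^ s • ⊤ = ⊥ := by
  obtain ⟨k, hk⟩ := m.exists_pow_inf_eq_pow_smul H
  refine ⟨k + 1, ?_⟩
  rw [inf_comm, hk (k + 1) (by lia), Nat.add_sub_cancel_left, pow_one, eq_bot_iff, ← h]
  exact smul_mono_right _ inf_le_right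

theorem exists_inf_pow_smul_eq_bot (hE : E.FG) (hH : H ≤ E) (h : m • H = ⊥) :
    ∃ s, H ⊓ m ^ s • E = ⊥ := by
  have : Module.Finite S E := Module.Finite.iff_fg.2 hE
  have hH' : (H.submoduleOf E).map E.subtype = H := by
    rw [Submodule.submoduleOf, Submodule.map_comap_subtype, inf_eq_right.2 hH]
  have hbot : m • H.submoduleOf E = ⊥ := Submodule.map_injective_of_injective E.injective_subtype
    (by rw [Submodule.map_smul'', hH', h, Submodule.map_bot])
  obtain ⟨s, hs⟩ := exists_inf_pow_smul_top_eq_bot m hbot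
  refine ⟨s, ?_⟩
  have hmap := congrArg (Submodule.map E.subtype) hs
  rwa [Submodule.map_inf _ E.injective_subtype, hH', Submodule.map_smul'', Submodule.map_top,
    Submodule.range_subtype, Submodule.map_bot] at hmap

theorem exists_inf_pow_smul_sup_le (hE : E.FG) (hH : H ≤ E) (h : m • H ≤ K) :
    ∃ s, H ⊓ (m ^ s • E ⊔ K) ≤ K := by
  have hbot : m • H.map K.mkQ = ⊥ := by
    rwa [← Submodule.map_smul'', ← LinearMap.le_ker_iff_map, Submodule.ker_mkQ]
  obtain ⟨s, hs⟩ := exists_inf_pow_smul_eq_bot m (hE.map K.mkQ) (Submodule.map_mono hH) hbot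
  refine ⟨s, ?_⟩
  nth_rw 2 [← K.ker_mkQ]
  rw [LinearMap.le_ker_iff_map, eq_bot_iff, ← hs]
  refine (Submodule.map_inf_le _).trans (inf_le_inf_left _ ?_)
  rw [Submodule.map_sup, Submodule.mkQ_map_self, sup_bot_eq, Submodule.map_smul'']

end ArtinRees

variable {A : Type*} [CommRing A] {N : Type*} [AddCommGroup N] [Module A N]

theorem single_mem_filtration_submodule {I : Ideal A} {F : I.Filtration N} {n : ℕ} {x : N} :
    PolynomialModule.single A n x ∈ F.submodule ↔ x ∈ F.N n := by
  rw [Ideal.Filtration.mem_submodule]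
  refine ⟨fun h => by simpa using h n, fun h i => ?_⟩
  rw [PolynomialModule.coeff_single, Finsupp.single_apply]
  split_ifs with hi
  · exact hi ▸ h
  · exact Submodule.zero_mem _

theorem map_smul_filtration_submodule_le {m I : Ideal A} {F G : I.Filtration N}
    (h : ∀ n, m • F.N n ≤ G.N n) :
    m.map (algebraMap A (reesAlgebra I)) • F.submodule ≤ G.submodule := by
  have hle : m.map (algebraMap A (reesAlgebra I)) ≤
      Submodule.colon G.submodule (F.submodule : Set (PolynomialModule A N)) := by
    rw [Ideal.map_le_iff_le_comap]
    intro a ha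
    rw [Ideal.mem_comap, Submodule.mem_colon]
    intro f hf i
    rw [algebraMap_smul]
    exact h i (Submodule.smul_mem_smul ha (hf i))
  exact Submodule.smul_le.2 fun r hr f hf => Submodule.mem_colon.1 (hle hr) f hf

theorem single_mem_map_smul {J I : Ideal A} {F : I.Filtration N} {n : ℕ} {x : N}
    (hx : x ∈ J • F.N n) :
    PolynomialModule.single A n x ∈ J.map (algebraMap A (reesAlgebra I)) • F.submodule := by
  refine Submodule.smul_induction_on hx (fun a ha y hy => ?_) fun y z hy hz => ?_
  · have hsmul : PolynomialModule.single A n (a • y) =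
        algebraMap A (reesAlgebra I) a • PolynomialModule.single A n y := by
      rw [algebraMap_smul]
      exact PolynomialModule.single_smul ..
    rw [hsmul]
    exact Submodule.smul_mem_smul (Ideal.mem_map_of_mem _ ha)
      (single_mem_filtration_submodule.2 hy)
  · rw [PolynomialModule.single_add]
    exact Submodule.add_mem _ hy hz

variable [IsNoetherianRing A] [Module.Finite A N]

theorem stableFiltration_submodule_fg (I : Ideal A) (D : Submodule A N) :
    (I.stableFiltration D).submodule.FG :=
  (Ideal.Filtration.submodule_fg_iff_stable _ fun _ => IsNoetherian.noetherian _).2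
    (I.stableFiltration_stable D)

/-- The exponent `s` works in all degrees at once because Artin–Rees is applied over the Rees
algebra. -/
theorem exists_inf_pow_smul_le (m I : Ideal A) (D : Submodule A N) (c : ℕ)
    (h : ∀ n, m • I ^ n • D ≤ I ^ (n + c) • ⊤) :
    ∃ s : ℕ, ∀ n, I ^ n • D ⊓ (m ^ s • I ^ n • ⊤ ⊔ I ^ (n + c) • ⊤) ≤ I ^ (n + c) • ⊤ := by
  let E := I.stableFiltration (⊤ : Submodule A N)
  let K := shiftFiltration c (I.stableFiltration (⊤ : Submodule A N))
  let H := I.stableFiltration D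
  have hHE : H.submodule ≤ E.submodule := fun f hf i =>
    (smul_mono_right _ le_top : I ^ i • D ≤ I ^ i • ⊤) (hf i)
  obtain ⟨s, hs⟩ := exists_inf_pow_smul_sup_le (m.map (algebraMap A (reesAlgebra I)))
    (K := K.submodule) (stableFiltration_submodule_fg I _) hHE (map_smul_filtration_submodule_le h)
  refine ⟨s, fun n x ⟨hxD, hx⟩ => ?_⟩
  obtain ⟨y, hy, z, hz, rfl⟩ := Submodule.mem_sup.1 hx
  refine single_mem_filtration_submodule.1 (hs ⟨single_mem_filtration_submodule.2 hxD, ?_⟩)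
  rw [PolynomialModule.single_add, ← Ideal.map_pow]
  exact Submodule.add_mem_sup (single_mem_map_smul hy) (single_mem_filtration_submodule.2 hz)

theorem exists_relativeLength_le_card_mul [IsLocalRing A] (I : Ideal A) (D : Submodule A N) (c : ℕ)
    (h : ∀ n, maximalIdeal A • I ^ n • D ≤ I ^ (n + c) • ⊤) :
    ∃ b : ℕ, ∀ (n : ℕ) (U : Finset N), Submodule.span A (U : Set N) = I ^ n • ⊤ →
      relativeLength (I ^ (n + c) • ⊤) (I ^ n • D) ≤ b * U.card := by
  obtain ⟨s, hs⟩ := exists_inf_pow_smul_le _ I D c h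
  obtain ⟨b, hb⟩ := ENat.ne_top_iff_exists.1 (length_quotient_pow_maximalIdeal_ne_top (A := A) s)
  refine ⟨b, fun n U hU => ?_⟩
  let Q := maximalIdeal A ^ s • I ^ n • ⊤ ⊔ I ^ (n + c) • (⊤ : Submodule A N)
  have hQ : I ^ n • D ⊓ I ^ (n + c) • ⊤ = I ^ n • D ⊓ Q :=
    le_antisymm (inf_le_inf_left _ le_sup_right) (le_inf inf_le_left (hs n))
  calc relativeLength (I ^ (n + c) • ⊤) (I ^ n • D) = relativeLength Q (I ^ n • D) := by
        rw [← relativeLength_inf_left, hQ, relativeLength_inf_left]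
    _ ≤ relativeLength Q (I ^ n • ⊤) := relativeLength_mono (smul_mono_right _ le_top)
    _ ≤ Fintype.card U * Module.length A (A ⧸ maximalIdeal A ^ s) :=
        relativeLength_le_card_mul (fun u : U => (u : N)) (by simp [hU]) fun a ha u =>
          Submodule.mem_sup_left (Submodule.smul_mem_smul ha (hU ▸ Submodule.subset_span u.2))
    _ = b * U.card := by rw [← hb, Fintype.card_coe, mul_comm]

end GradedArtinRees

section GelfandKirillov

open Module MvPolynomial

theorem ringKrullDim_le_of_isIntegral_of_injective {R S : Type*} [CommRing R] [CommRing S]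
    (f : R →+* S) (hf : f.IsIntegral) (hf' : Function.Injective f) :
    ringKrullDim R ≤ ringKrullDim S := by
  algebraize [f]
  refine iSup_le fun l => ?_
  have hker : (⊥ : Ideal S).comap (algebraMap R S) ≤ l.head.asIdeal := by
    rw [← RingHom.ker_eq_comap_bot, (RingHom.injective_iff_ker_eq_bot (algebraMap R S)).1 hf']
    exact bot_le
  obtain ⟨P, -, hP, hP'⟩ := Ideal.exists_ideal_over_prime_of_isIntegral l.head.asIdeal ⊥ hker
  have : P.LiesOver l.head.asIdeal := ⟨hP'.symm⟩
  obtain ⟨L, hL, -⟩ := Ideal.exists_ltSeries_of_hasGoingUp l P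
  rw [← hL]
  exact Order.LTSeries.length_le_krullDim L

section RestrictDegree

variable {σ R : Type*} [CommRing R]

theorem restrictDegree_mono : Monotone (restrictDegree σ R) :=
  fun _ _ h => restrictSupport_mono R fun _ hd i => (hd i).trans h

theorem exists_mem_restrictDegree (p : MvPolynomial σ R) : ∃ D, p ∈ restrictDegree σ R D :=
  ⟨_, restrictTotalDegree_le_restrictDegree σ R _ ((mem_restrictTotalDegree σ _ p).2 le_rfl)⟩

theorem restrictDegree_pow_le (D n : ℕ) :
    restrictDegree σ R D ^ n ≤ restrictDegree σ R (n * D) := by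
  induction n with
  | zero =>
    rw [pow_zero, ← restrictSupport_zero]
    exact restrictSupport_mono R fun d hd i => by simp [Set.mem_zero.1 hd]
  | succ n ih =>
    rw [pow_succ]
    refine (mul_le_mul_left ih _).trans ?_
    rw [restrictDegree, restrictDegree, ← restrictSupport_add]
    refine restrictSupport_mono R ?_
    rintro _ ⟨d, hd, e, he, rfl⟩ i
    rw [add_one_mul]
    exact add_le_add (hd i) (he i)

theorem finrank_restrictDegree [StrongRankCondition R] [Fintype σ] (D : ℕ) :
    finrank R (restrictDegree σ R D) = (D + 1) ^ Fintype.card σ := by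
  classical
  let e : {d : σ →₀ ℕ | ∀ i, d i ≤ D} ≃ (σ → Fin (D + 1)) :=
    { toFun d i := ⟨d.1 i, Nat.lt_succ_of_le (d.2 i)⟩
      invFun d := ⟨Finsupp.equivFunOnFinite.symm fun i => d i, fun i => Nat.le_of_lt_succ (d i).2⟩
      left_inv d := by ext; rfl
      right_inv d := by ext; rfl }
  have : finrank R (restrictDegree σ R D) = _ :=
    finrank_eq_card_basis ((basisRestrictSupport R _).reindex e)
  rw [this, Fintype.card_fun, Fintype.card_fin]

end RestrictDegree

theorem pow_mul_le_pow_mul {P : Type*} [CommMonoid P] [Preorder P] [MulLeftMono P] {a b c : P}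
    (h : a * c ≤ b * c) (n : ℕ) : a ^ n * c ≤ b ^ n * c := by
  induction n with
  | zero => rw [pow_zero, pow_zero]
  | succ n ih =>
    calc a ^ (n + 1) * c = a ^ n * (a * c) := by rw [pow_succ, mul_assoc]
      _ ≤ a ^ n * (b * c) := mul_le_mul_right h _
      _ = b * (a ^ n * c) := mul_left_comm _ _ _
      _ ≤ b * (b ^ n * c) := mul_le_mul_right ih _
      _ = b ^ (n + 1) * c := by rw [pow_succ', mul_assoc]

variable {σ k B : Type*} [Field k] [CommRing B] [Algebra k B]

theorem finrank_mul_le (P Q : Submodule k B) [Module.Finite k P] [Module.Finite k Q] :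
    finrank k (P * Q : Submodule k B) ≤ finrank k P * finrank k Q := by
  rw [← Submodule.mulMap_range, ← Module.finrank_tensorProduct]
  exact LinearMap.finrank_range_le _

theorem exists_le_map_restrictDegree_mul {g : MvPolynomial σ k →ₐ[k] B} (hg : g.Finite) :
    ∃ T : Submodule k B, T.FG ∧ 1 ≤ T ∧ ∀ V : Submodule k B, V.FG →
      ∃ D, V ≤ (restrictDegree σ k D).map g.toLinearMap * T := by
  obtain ⟨b, hb⟩ : ∃ b : Finset B, ∀ v, ∃ c : B → MvPolynomial σ k, v = ∑ x ∈ b, g (c x) * x := by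
    let _ := g.toRingHom.toAlgebra
    obtain ⟨b, hb⟩ := Module.Finite.fg_top (self := hg)
    refine ⟨b, fun v => ?_⟩
    obtain ⟨c, -, hc⟩ := Submodule.mem_span_finset.1
      (hb ▸ Submodule.mem_top : v ∈ Submodule.span (MvPolynomial σ k) (b : Set B))
    exact ⟨c, hc.symm⟩
  let T := Submodule.span k (insert 1 (b : Set B))
  have hmono : Monotone fun D => (restrictDegree σ k D).map g.toLinearMap * T := fun D E h =>
    mul_le_mul_left (Submodule.map_mono (restrictDegree_mono h)) T
  have hexhaust : ∀ v, ∃ D, v ∈ (restrictDegree σ k D).map g.toLinearMap * T := by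
    intro v
    obtain ⟨c, rfl⟩ := hb v
    choose D hD using fun x => exists_mem_restrictDegree (c x)
    refine ⟨b.sup D, Submodule.sum_mem _ fun x hx => hmono (Finset.le_sup hx) ?_⟩
    exact Submodule.mul_mem_mul ⟨_, hD x, rfl⟩ (Submodule.subset_span (Set.mem_insert_of_mem _ hx))
  refine ⟨T, Submodule.fg_span (by simp), Submodule.one_le.2 (Submodule.subset_span (by simp)), ?_⟩
  rintro _ ⟨t, rfl⟩
  choose D hD using hexhaust
  exact ⟨t.sup D, Submodule.span_le.2 fun x hx => hmono (Finset.le_sup hx) (hD x)⟩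

theorem exists_finrank_pow_le_of_finite [Fintype σ] {g : MvPolynomial σ k →ₐ[k] B} (hg : g.Finite)
    {V : Submodule k B} (hV : V.FG) :
    ∃ C : ℕ, ∀ n, finrank k (V ^ n : Submodule k B) ≤ C * (n + 1) ^ Fintype.card σ := by
  obtain ⟨T, hT, hT₁, hexhaust⟩ := exists_le_map_restrictDegree_mul hg
  have : Module.Finite k T := Module.Finite.iff_fg.2 hT
  obtain ⟨D, hD⟩ := hexhaust (V * T) (hV.mul hT)
  refine ⟨(D + 1) ^ Fintype.card σ * finrank k T, fun n => ?_⟩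
  let W := restrictDegree σ k (n * D)
  have hVW : V ^ n ≤ W.map g.toLinearMap * T :=
    calc V ^ n = V ^ n * 1 := (mul_one _).symm
      _ ≤ V ^ n * T := mul_le_mul_right hT₁ _
      _ ≤ (restrictDegree σ k D).map g.toLinearMap ^ n * T := pow_mul_le_pow_mul hD n
      _ = (restrictDegree σ k D ^ n).map g.toLinearMap * T := by rw [Submodule.map_pow]
      _ ≤ W.map g.toLinearMap * T :=
        mul_le_mul_left (Submodule.map_mono (restrictDegree_pow_le D n)) T
  have : Module.Finite k (W.map g.toLinearMap * T : Submodule k B) :=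
    Module.Finite.iff_fg.2 ((Module.Finite.iff_fg.1 inferInstance).mul hT)
  calc finrank k (V ^ n : Submodule k B)
      ≤ finrank k (W.map g.toLinearMap * T : Submodule k B) := Submodule.finrank_mono hVW
    _ ≤ finrank k (W.map g.toLinearMap) * finrank k T := finrank_mul_le _ _
    _ ≤ (n * D + 1) ^ Fintype.card σ * finrank k T := by
        gcongr
        exact (Submodule.finrank_map_le _ _).trans_eq (finrank_restrictDegree _)
    _ ≤ ((D + 1) * (n + 1)) ^ Fintype.card σ * finrank k T := by
        gcongr
        nlinarith
    _ = _ := by rw [mul_pow]; ring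

variable (k B) in
theorem exists_finrank_pow_le [Nontrivial B] [Algebra.FiniteType k B] :
    ∃ s : ℕ, (s : WithBot ℕ∞) ≤ ringKrullDim B ∧ ∀ V : Submodule k B, V.FG →
      ∃ C : ℕ, ∀ n, finrank k (V ^ n : Submodule k B) ≤ C * (n + 1) ^ s := by
  obtain ⟨s, g, hg, hfin⟩ := exists_finite_inj_algHom_of_fg k B
  refine ⟨s, ?_, fun V hV => ?_⟩
  · have hdim := ringKrullDim_le_of_isIntegral_of_injective g.toRingHom hfin.to_isIntegral hg
    simpa [MvPolynomial.ringKrullDim_of_isNoetherianRing, ringKrullDim_eq_zero_of_field] using hdim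
  · simpa using exists_finrank_pow_le_of_finite hfin hV

theorem exists_hasGrowthAtMost_length_pow {A : Type*} [CommRing A] [Algebra A k] [Algebra A B]
    [IsScalarTower A k B] (hk : Function.Surjective (algebraMap A k)) [Nontrivial B]
    [Algebra.FiniteType A B] :
    ∃ s : ℕ, (s : WithBot ℕ∞) ≤ ringKrullDim B ∧ ∀ V : Submodule A B, V.FG →
      HasGrowthAtMost s fun n => Module.length A ↥(V ^ n) := by
  have : Algebra.FiniteType k B := Algebra.FiniteType.of_restrictScalars_finiteType A k B
  obtain ⟨s, hs, hgrowth⟩ := exists_finrank_pow_le k B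
  refine ⟨s, hs, ?_⟩
  rintro _ ⟨t, rfl⟩
  obtain ⟨C, hC⟩ := hgrowth (Submodule.span k t) ⟨t, rfl⟩
  refine ⟨C, fun n => ?_⟩
  have hW : Submodule.span A (t : Set B) ^ n =
      (Submodule.span k (t : Set B) ^ n).restrictScalars A := by
    rw [Submodule.span_pow, Submodule.span_pow, Submodule.restrictScalars_span A k hk]
  set W := Submodule.span k (t : Set B) ^ n
  have : Module.Finite k W := Module.Finite.iff_fg.2 (Submodule.FG.pow ⟨t, rfl⟩ n)
  calc Module.length A ↥(Submodule.span A (t : Set B) ^ n)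
      = Module.length A (W.restrictScalars A) := by rw [hW]
    _ = Module.length A W := rfl
    _ = Module.length k W := Module.length_eq_of_surjective hk
    _ = finrank k W := Module.length_eq_finrank _ _
    _ ≤ _ := by exact_mod_cast hC n

end GelfandKirillov

section FiberCone

section SpanLength

theorem relativeLength_smul_span_le {A S E : Type*} [CommRing A] [CommRing S] [Algebra A S]
    [AddCommGroup E] [Module A E] [Module S E] [IsScalarTower A S E] (K : Submodule S E)
    (a : Ideal S) (P : Submodule A S) (U : Finset E) (h : ∀ u ∈ U, ∀ s ∈ a, s • u ∈ K) :
    relativeLength (K.restrictScalars A) (P • Submodule.span A (U : Set E)) ≤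
      U.card * relativeLength (a.restrictScalars A) P := by
  classical
  induction U using Finset.induction_on with
  | empty =>
    rw [Finset.coe_empty, Submodule.span_empty, Submodule.smul_bot,
      relativeLength_eq_zero_iff.2 bot_le]
    exact zero_le
  | insert u U hu ih =>
    let f : S →ₗ[A] E := (LinearMap.toSpanSingleton S E u).restrictScalars A
    have hf : P • Submodule.span A {u} ≤ P.map f := Submodule.smul_le.2 fun s hs x hx => by
      obtain ⟨r, rfl⟩ := Submodule.mem_span_singleton.1 hx
      exact ⟨r • s, P.smul_mem r hs, by simp [f, smul_comm s r u]⟩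
    have hu' : relativeLength (K.restrictScalars A) (P • Submodule.span A {u}) ≤
        relativeLength (a.restrictScalars A) P :=
      calc _ ≤ relativeLength (K.restrictScalars A) (P.map f) := relativeLength_mono hf
        _ = relativeLength ((K.restrictScalars A).comap f) P := relativeLength_map ..
        _ ≤ _ := relativeLength_anti fun s hs => h u (Finset.mem_insert_self _ _) s hs
    rw [Finset.coe_insert, Submodule.span_insert, Submodule.smul_sup,
      Finset.card_insert_of_notMem hu, Nat.cast_add_one, add_one_mul, add_comm]
    exact (relativeLength_sup_le _ _ _).trans
      (add_le_add hu' (ih fun x hx => h x (Finset.mem_insert_of_mem hx)))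

variable {A : Type*} [CommRing A] [IsLocalRing A] {N : Type*} [AddCommGroup N] [Module A N]

theorem spanFinrank_le_relativeLength {J : Submodule A N} (hJ : J.FG) :
    (J.spanFinrank : ℕ∞) ≤ relativeLength (maximalIdeal A • J) J := by
  have e : (maximalIdeal A • J).submoduleOf J = maximalIdeal A • (⊤ : Submodule A J) := by
    apply Submodule.map_injective_of_injective J.subtype_injective
    rw [Submodule.map_smul'', Submodule.map_top, Submodule.range_subtype, Submodule.submoduleOf,
      Submodule.map_comap_subtype, inf_eq_right]
    exact Submodule.smul_le_right
  let _ : Field (A ⧸ maximalIdeal A) := Ideal.Quotient.field _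
  have : Module.Finite A J := Module.Finite.iff_fg.2 hJ
  have : Module.Finite (A ⧸ maximalIdeal A) (J ⧸ maximalIdeal A • (⊤ : Submodule A J)) :=
    Module.Finite.of_restrictScalars_finite A _ _
  rw [relativeLength, e, IsLocalRing.spanFinrank_eq_finrank_quotient J hJ,
    Module.length_eq_of_surjective (R := A ⧸ maximalIdeal A) Ideal.Quotient.mk_surjective,
    Module.length_eq_finrank]

end SpanLength

section ReesModule

variable {A : Type*} [CommRing A] (I : Ideal A) (N : Type*) [AddCommGroup N] [Module A N]

/-- The part of the Rees algebra in degrees at most `1`. Its powers exhaust the Rees algebra. -/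
noncomputable def reesDegreeLEOne : Submodule A (reesAlgebra I) :=
  (degreeLE A 1).comap (reesAlgebra I).val.toLinearMap

theorem one_le_reesDegreeLEOne : 1 ≤ reesDegreeLEOne I :=
  Submodule.one_le.2 (mem_degreeLE.2 (degree_one_le.trans (by simp)))

theorem reesDegreeLEOne_fg [IsNoetherianRing A] : (reesDegreeLEOne I).FG := by
  classical
  have hfg : (degreeLE A 1).FG := by
    rw [show (1 : WithBot ℕ) = (1 : ℕ) from rfl, degreeLE_eq_span_X_pow]
    exact ⟨_, rfl⟩
  exact Submodule.fg_of_fg_map_injective (reesAlgebra I).val.toLinearMap Subtype.val_injective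
    (isNoetherian_submodule.1 (isNoetherian_of_fg_of_noetherian _ hfg) _
      (Submodule.map_comap_le _ _))

variable {I N}

theorem single_mem_reesDegreeLEOne_pow_smul (i : ℕ) {x : N}
    (hx : x ∈ I ^ i • (⊤ : Submodule A N)) :
    PolynomialModule.single A i x ∈
      reesDegreeLEOne I ^ i • LinearMap.range (PolynomialModule.lsingle A 0 : N →ₗ[A] _) := by
  induction i generalizing x with
  | zero =>
    rw [pow_zero, Submodule.one_smul]
    exact ⟨x, rfl⟩
  | succ i ih =>
    rw [pow_succ', mul_smul] at hx
    rw [pow_succ', ← smul_eq_mul, Submodule.smul_assoc]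
    refine Submodule.smul_induction_on hx (fun a ha y hy => ?_) fun y z hy hz => ?_
    · let aT : reesAlgebra I := ⟨monomial 1 a, reesAlgebra.monomial_mem.2 (by rwa [pow_one])⟩
      have hat : aT ∈ reesDegreeLEOne I := mem_degreeLE.2 (degree_monomial_le 1 a)
      have hsmul : PolynomialModule.single A (i + 1) (a • y) =
          aT • PolynomialModule.single A i y := by
        rw [add_comm]
        exact (PolynomialModule.monomial_smul_single ..).symm
      rw [hsmul]
      exact Submodule.smul_mem_smul hat (ih hy)
    · rw [PolynomialModule.single_add]
      exact Submodule.add_mem _ hy hz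

end ReesModule

end FiberCone

section FiberConeGrowth

variable {A : Type*} [CommRing A] {I : Ideal A} {N : Type*} [AddCommGroup N] [Module A N]

theorem sum_relativeLength_le_of_single_mem (F G : I.Filtration N) (n : ℕ)
    (W : Submodule A (PolynomialModule A N))
    (hW : ∀ i < n, ∀ x ∈ F.N i, PolynomialModule.single A i x ∈ W) :
    ∑ i ∈ Finset.range n, relativeLength (G.N i) (F.N i) ≤
      relativeLength (G.submodule.restrictScalars A) W := by
  let c : PolynomialModule A N →ₗ[A] (Fin n → N) := LinearMap.pi fun i =>
    Finsupp.lapply (i : ℕ) ∘ₗ (PolynomialModule.coeffLinearEquiv A A).toLinearMap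
  have hmap : Submodule.pi Set.univ (fun i : Fin n => F.N i) ≤ W.map c := fun x hx => by
    refine ⟨∑ i : Fin n, PolynomialModule.single A i (x i),
      W.sum_mem fun i _ => hW i i.2 _ (hx i trivial), funext fun j => ?_⟩
    change PolynomialModule.coeff _ (j : ℕ) = x j
    simp [PolynomialModule.coeff_sum, Finsupp.finsetSum_apply, Finsupp.single_apply, Fin.val_inj]
  calc ∑ i ∈ Finset.range n, relativeLength (G.N i) (F.N i)
      = ∑ i : Fin n, relativeLength (G.N i) (F.N i) := Finset.sum_range _
    _ = relativeLength (Submodule.pi Set.univ fun i : Fin n => G.N i)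
          (Submodule.pi Set.univ fun i : Fin n => F.N i) := (relativeLength_pi _ _).symm
    _ ≤ relativeLength (Submodule.pi Set.univ fun i : Fin n => G.N i) (W.map c) :=
        relativeLength_mono hmap
    _ = relativeLength ((Submodule.pi Set.univ fun i : Fin n => G.N i).comap c) W :=
        relativeLength_map ..
    _ ≤ relativeLength (G.submodule.restrictScalars A) W :=
        relativeLength_anti fun f hf i _ => hf i

/-- The filtration `𝔞 F_n`. -/
def smulFiltration (𝔞 : Ideal A) (F : I.Filtration N) : I.Filtration N where
  N i := 𝔞 • F.N i
  mono i := smul_mono_right _ (F.mono i)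
  smul_le i := by
    rw [smul_comm I]
    exact smul_mono_right _ (F.smul_le i)

theorem exists_sum_spanFinrank_le [IsLocalRing A] [IsNoetherianRing A] [Module.Finite A N]
    {a : Ideal (reesAlgebra I)}
    (ha : a • (I.stableFiltration (⊤ : Submodule A N)).submodule ≤
      (maximalIdeal A).map (algebraMap A (reesAlgebra I)) • (I.stableFiltration ⊤).submodule) :
    ∃ b : ℕ, ∀ n, ∑ i ∈ Finset.range n, ((I ^ i • ⊤ : Submodule A N).spanFinrank : ℕ∞) ≤
      b * relativeLength (a.restrictScalars A) (reesDegreeLEOne I ^ n) := by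
  classical
  obtain ⟨U, hU⟩ := IsNoetherian.noetherian (⊤ : Submodule A N)
  let F := I.stableFiltration (⊤ : Submodule A N)
  let G := smulFiltration (maximalIdeal A) F
  let U₀ := U.image (PolynomialModule.single A 0)
  have hU₀ : Submodule.span A (U₀ : Set (PolynomialModule A N)) =
      LinearMap.range (PolynomialModule.lsingle A 0 : N →ₗ[A] _) := by
    rw [LinearMap.range_eq_map, ← hU, Submodule.map_span, Finset.coe_image]
    rfl
  have hG : ∀ u ∈ U₀, ∀ s ∈ a, s • u ∈ G.submodule := fun u hu s hs => by
    obtain ⟨x, -, rfl⟩ := Finset.mem_image.1 hu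
    refine map_smul_filtration_submodule_le (fun _ => le_rfl) (ha (Submodule.smul_mem_smul hs ?_))
    exact single_mem_filtration_submodule.2
      (show x ∈ I ^ 0 • (⊤ : Submodule A N) by rw [pow_zero, Submodule.one_smul]; trivial)
  refine ⟨U₀.card, fun n => ?_⟩
  calc ∑ i ∈ Finset.range n, ((I ^ i • ⊤ : Submodule A N).spanFinrank : ℕ∞)
      ≤ ∑ i ∈ Finset.range n, relativeLength (G.N i) (F.N i) :=
        Finset.sum_le_sum fun i _ => spanFinrank_le_relativeLength (IsNoetherian.noetherian _)
    _ ≤ relativeLength (G.submodule.restrictScalars A)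
          (reesDegreeLEOne I ^ n • Submodule.span A (U₀ : Set (PolynomialModule A N))) :=
        sum_relativeLength_le_of_single_mem F G n _ fun i hi x hx => hU₀ ▸
          Submodule.smul_mono_left (pow_le_pow_right₀ (one_le_reesDegreeLEOne I) hi.le)
            (single_mem_reesDegreeLEOne_pow_smul i hx)
    _ ≤ U₀.card * relativeLength (a.restrictScalars A) (reesDegreeLEOne I ^ n) :=
        relativeLength_smul_span_le _ _ _ _ hG

theorem exists_hasGrowthAtMost_relativeLength_pow {A S : Type*} [CommRing A] [IsLocalRing A]
    [CommRing S] [Algebra A S] [Algebra.FiniteType A S] {a : Ideal S} (ha : a ≠ ⊤)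
    (h : (maximalIdeal A).map (algebraMap A S) ≤ a) :
    ∃ s : ℕ, (s : WithBot ℕ∞) ≤ ringKrullDim (S ⧸ a) ∧ ∀ V : Submodule A S, V.FG →
      HasGrowthAtMost s fun n => relativeLength (a.restrictScalars A) (V ^ n) := by
  let _ : Field (A ⧸ maximalIdeal A) := Ideal.Quotient.field _
  let _ : Algebra (A ⧸ maximalIdeal A) (S ⧸ a) :=
    Ideal.Quotient.algebraQuotientOfLEComap (Ideal.map_le_iff_le_comap.1 h)
  have : IsScalarTower A (A ⧸ maximalIdeal A) (S ⧸ a) := .of_algebraMap_eq' rfl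
  have : Nontrivial (S ⧸ a) := Ideal.Quotient.nontrivial_iff.2 ha
  obtain ⟨s, hs, hV⟩ := exists_hasGrowthAtMost_length_pow (k := A ⧸ maximalIdeal A)
    (B := S ⧸ a) (A := A) Ideal.Quotient.mk_surjective
  refine ⟨s, hs, fun V hVfg => ?_⟩
  let π := Ideal.Quotient.mkₐ A a
  have hker : (⊥ : Submodule A (S ⧸ a)).comap π.toLinearMap = a.restrictScalars A :=
    Submodule.ext fun x => Ideal.Quotient.eq_zero_iff_mem
  refine (hV (V.map π.toLinearMap) (hVfg.map _)).mono fun n => le_of_eq ?_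
  rw [← hker, ← relativeLength_map, Submodule.map_pow, relativeLength_bot]

theorem annihilator_quotient_smul_top_le {S P : Type*} [CommRing S] [AddCommGroup P] [Module S P]
    (K : Submodule S P) : Module.annihilator S (P ⧸ K) • ⊤ ≤ K := by
  rw [Submodule.annihilator_quotient]
  exact Submodule.smul_le.2 fun s hs x _ => Submodule.mem_colon.1 hs x trivial

theorem annihilator_quotient_smul_top_smul_le {S P : Type*} [CommRing S] [AddCommGroup P]
    [Module S P] (E : Submodule S P) (J : Ideal S) :
    Module.annihilator S (E ⧸ (J • ⊤ : Submodule S E)) • E ≤ J • E := by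
  simpa only [Submodule.map_smul'', Submodule.map_top, Submodule.range_subtype] using
    Submodule.map_mono (f := E.subtype)
      (annihilator_quotient_smul_top_le (J • ⊤ : Submodule S E))

theorem le_annihilator_quotient_smul_top {S E : Type*} [CommRing S] [AddCommGroup E]
    [Module S E] (J : Ideal S) : J ≤ Module.annihilator S (E ⧸ (J • ⊤ : Submodule S E)) := by
  rw [Submodule.annihilator_quotient]
  exact fun s hs => Submodule.mem_colon.2 fun x hx => Submodule.smul_mem_smul hs hx

variable {A N : Type*} [CommRing A] [IsLocalRing A] [AddCommGroup N] [Module A N]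
  [Module.Finite A N] [Nontrivial N] (I : Ideal A)

theorem maximalIdeal_smul_top_ne_top : maximalIdeal A • (⊤ : Submodule A N) ≠ ⊤ := fun h =>
  top_ne_bot (Submodule.eq_bot_of_le_smul_of_le_jacobson_bot _ _ Module.Finite.fg_top h.ge
    (maximalIdeal_le_jacobson _))

theorem not_stableFiltration_submodule_le_smul :
    ¬ (I.stableFiltration (⊤ : Submodule A N)).submodule ≤
      (maximalIdeal A).map (algebraMap A (reesAlgebra I)) •
        (I.stableFiltration (⊤ : Submodule A N)).submodule := fun h => by
  let F := I.stableFiltration (⊤ : Submodule A N)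
  refine maximalIdeal_smul_top_ne_top (A := A) (N := N) (eq_top_iff.2 fun x _ => ?_)
  have hx : x ∈ F.N 0 := by
    change x ∈ I ^ 0 • ⊤
    rw [pow_zero, Submodule.one_smul]
    trivial
  have hle : maximalIdeal A • F.N 0 ≤ maximalIdeal A • ⊤ := smul_mono_right _ le_top
  exact hle (single_mem_filtration_submodule.1 (map_smul_filtration_submodule_le
    (G := smulFiltration (maximalIdeal A) F) (fun _ => le_rfl)
    (h (single_mem_filtration_submodule.2 hx))))

theorem exists_hasGrowthAtMost_sum_spanFinrank [IsNoetherianRing A] :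
    ∃ s : ℕ, (s : WithBot ℕ∞) ≤ Module.supportDim (reesAlgebra I)
        (ReesModule I N ⧸ ((maximalIdeal A).map (algebraMap A (reesAlgebra I)) • ⊤ :
          Submodule (reesAlgebra I) (ReesModule I N))) ∧
      HasGrowthAtMost s fun n =>
        ∑ i ∈ Finset.range n, ((I ^ i • ⊤ : Submodule A N).spanFinrank : ℕ∞) := by
  let E := (I.stableFiltration (⊤ : Submodule A N)).submodule
  let J := (maximalIdeal A).map (algebraMap A (reesAlgebra I))
  let a := Module.annihilator (reesAlgebra I)
    (ReesModule I N ⧸ (J • ⊤ : Submodule (reesAlgebra I) (ReesModule I N)))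
  have haE : a • E ≤ J • E := annihilator_quotient_smul_top_smul_le E J
  have ha : a ≠ ⊤ := fun h => not_stableFiltration_submodule_le_smul I (N := N) <| by
    rwa [h, Submodule.top_smul] at haE
  obtain ⟨s, hs, hV⟩ := exists_hasGrowthAtMost_relativeLength_pow ha
    (le_annihilator_quotient_smul_top J)
  obtain ⟨b, hb⟩ := exists_sum_spanFinrank_le haE
  have : Module.Finite (reesAlgebra I) (ReesModule I N) :=
    Module.Finite.iff_fg.2 (stableFiltration_submodule_fg I _)
  refine ⟨s, ?_, ((hV _ (reesDegreeLEOne_fg I)).const_mul b).mono hb⟩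
  rwa [Module.supportDim_eq_ringKrullDim_quotient_annihilator]

end FiberConeGrowth

section AnalyticSpread

theorem supportDim_eq_of_surjective_algebraMap {S G X : Type*} [CommRing S] [CommRing G]
    [Algebra S G] [AddCommGroup X] [Module S X] [Module G X] [IsScalarTower S G X]
    [Module.Finite S X] (h : Function.Surjective (algebraMap S G)) :
    Module.supportDim G X = Module.supportDim S X := by
  have : Module.Finite G X := .of_restrictScalars_finite S G X
  let f : S →+* G ⧸ Module.annihilator G X := (Ideal.Quotient.mk _).comp (algebraMap S G)
  have hf : Function.Surjective f := Ideal.Quotient.mk_surjective.comp h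
  have hker : RingHom.ker f = Module.annihilator S X := by
    rw [← RingHom.comap_ker, Ideal.mk_ker, Module.comap_annihilator]
  rw [Module.supportDim_eq_ringKrullDim_quotient_annihilator,
    Module.supportDim_eq_ringKrullDim_quotient_annihilator, ← hker]
  exact (ringKrullDim_eq_of_ringEquiv (RingHom.quotientKerEquivOfSurjective hf)).symm

theorem supportDim_quotient_smul_top {S E : Type*} [CommRing S] [AddCommGroup E] [Module S E]
    [Module.Finite S E] {a J : Ideal S} (h : a ≤ J) :
    Module.supportDim (S ⧸ a) ((E ⧸ (a • ⊤ : Submodule S E)) ⧸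
        (J.map (Ideal.Quotient.mk a) • ⊤ : Submodule (S ⧸ a) (E ⧸ (a • ⊤ : Submodule S E)))) =
      Module.supportDim S (E ⧸ (J • ⊤ : Submodule S E)) := by
  let Q : Submodule (S ⧸ a) (E ⧸ (a • ⊤ : Submodule S E)) := J.map (Ideal.Quotient.mk a) • ⊤
  have hQ : Q.restrictScalars S = (J • ⊤ : Submodule S E).map (Submodule.mkQ _) := by
    rw [Submodule.map_smul'', Submodule.map_top, Submodule.range_mkQ]
    exact Ideal.smul_restrictScalars J ⊤
  rw [supportDim_eq_of_surjective_algebraMap (S := S) Ideal.Quotient.mk_surjective]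
  exact Module.supportDim_eq_of_equiv
    ((Submodule.Quotient.restrictScalarsEquiv S Q).symm ≪≫ₗ Submodule.quotEquivOfEq _ _ hQ ≪≫ₗ
      Submodule.quotientQuotientEquivQuotient _ _ (Submodule.smul_mono_left h))

theorem exists_hasGrowthAtMost_sum_spanFinrank_localAnalyticSpread {A N : Type*} [CommRing A]
    [IsLocalRing A] [IsNoetherianRing A] [AddCommGroup N] [Module A N] [Module.Finite A N]
    [Nontrivial N] {I : Ideal A} (hI : I ≤ maximalIdeal A) :
    ∃ s : ℕ, (s : WithBot ℕ∞) ≤ localAnalyticSpread I N ∧ HasGrowthAtMost s fun n =>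
      ∑ i ∈ Finset.range n, ((I ^ i • ⊤ : Submodule A N).spanFinrank : ℕ∞) := by
  obtain ⟨s, hs, h⟩ := exists_hasGrowthAtMost_sum_spanFinrank (N := N) I
  have : Module.Finite (reesAlgebra I) (ReesModule I N) :=
    Module.Finite.iff_fg.2 (stableFiltration_submodule_fg I _)
  rw [← supportDim_quotient_smul_top (Ideal.map_mono hI), Ideal.map_map] at hs
  exact ⟨s, hs, h⟩

end AnalyticSpread

section DimensionBound

variable {A : Type*} [CommRing A]

theorem length_quotient_anti {N : Type*} [AddCommGroup N] [Module A N] {K L : Submodule A N}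
    (h : K ≤ L) : Module.length A (N ⧸ L) ≤ Module.length A (N ⧸ K) :=
  Module.length_le_of_surjective (Submodule.factor h) (Submodule.factor_surjective h)

variable [IsNoetherianRing A]

theorem exists_comap_toSpanSingleton_pow_smul_le {N : Type*} [AddCommGroup N] [Module A N]
    [Module.Finite A N] (I : Ideal A) (x : N) :
    ∃ c : ℕ, ∀ n, (I ^ (n + c) • (⊤ : Submodule A N)).comap (LinearMap.toSpanSingleton A N x) ≤
      LinearMap.ker (LinearMap.toSpanSingleton A N x) ⊔ I ^ n := by
  obtain ⟨c, hc⟩ := I.exists_pow_inf_eq_pow_smul (Submodule.span A {x})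
  refine ⟨c, fun n a ha => ?_⟩
  have hax : a • x ∈ I ^ n • Submodule.span A {x} := by
    have h : a • x ∈ I ^ (n + c) • ⊤ ⊓ Submodule.span A {x} :=
      ⟨ha, Submodule.smul_mem _ _ (Submodule.mem_span_singleton_self x)⟩
    rw [hc (n + c) (by lia), Nat.add_sub_cancel] at h
    exact (smul_mono_right (I ^ n) inf_le_right : _ ≤ I ^ n • Submodule.span A {x}) h
  obtain ⟨b, hb, hbx⟩ := Submodule.mem_smul_span_singleton.1 hax
  rw [← sub_add_cancel a b]
  refine Submodule.add_mem_sup ?_ hb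
  rw [LinearMap.mem_ker, LinearMap.toSpanSingleton_apply, sub_smul, hbx, sub_self]

variable {I : Ideal A}

theorem exists_length_quotient_sup_pow_add_le (p : Ideal A) [p.IsPrime] {x : A} (hx : x ∉ p) :
    ∃ c : ℕ, ∀ n, Module.length A (A ⧸ p ⊔ I ^ n) +
      Module.length A (A ⧸ p ⊔ Ideal.span {x} ⊔ I ^ (n + c)) ≤
        Module.length A (A ⧸ p ⊔ I ^ (n + c)) := by
  obtain ⟨c, hc⟩ := exists_comap_toSpanSingleton_pow_smul_le I (Submodule.Quotient.mk x : A ⧸ p)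
  refine ⟨c, fun n => ?_⟩
  let K := p ⊔ I ^ (n + c)
  let f := LinearMap.toSpanSingleton A A x
  have hf : p.mkQ ∘ₗ f = LinearMap.toSpanSingleton A (A ⧸ p) (Submodule.Quotient.mk x) :=
    LinearMap.ext fun a => rfl
  have hker : LinearMap.ker (p.mkQ ∘ₗ f) ≤ p := fun a ha =>
    (Ideal.IsPrime.mem_or_mem ‹_› ((Submodule.Quotient.mk_eq_zero p).1 ha)).resolve_right hx
  have hK : K ≤ (I ^ (n + c) • ⊤ : Submodule A (A ⧸ p)).comap p.mkQ := by
    refine sup_le (Submodule.le_comap_mkQ p _) fun z hz => ?_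
    rw [Submodule.mem_comap, ← mul_one z, ← smul_eq_mul, map_smul]
    exact Submodule.smul_mem_smul hz trivial
  have hcomap : Submodule.comap f K ≤ p ⊔ I ^ n :=
    calc Submodule.comap f K ≤ (I ^ (n + c) • ⊤ : Submodule A (A ⧸ p)).comap (p.mkQ ∘ₗ f) :=
          Submodule.comap_mono hK
      _ ≤ LinearMap.ker (p.mkQ ∘ₗ f) ⊔ I ^ n := by rw [hf]; exact hc n
      _ ≤ p ⊔ I ^ n := sup_le_sup_right hker _
  have hlength : Module.length A (A ⧸ Submodule.comap f K) =
      relativeLength K (Ideal.span {x} ⊔ K) := by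
    rw [relativeLength_sup, ← relativeLength_top, ← relativeLength_map, ← LinearMap.range_eq_map,
      LinearMap.range_toSpanSingleton]
  have hsup : p ⊔ Ideal.span {x} ⊔ I ^ (n + c) = Ideal.span {x} ⊔ K := by
    rw [sup_comm p, sup_assoc]
  rw [length_quotient_eq_add (le_sup_right : K ≤ Ideal.span {x} ⊔ K), hsup, ← hlength]
  gcongr
  exact length_quotient_anti hcomap

theorem hasGrowthAtMost_succ_mul_length_quotient (p : Ideal A) [p.IsPrime] {x : A} (hx : x ∉ p)
    {d : ℕ} (h : HasGrowthAtMost d fun n => Module.length A (A ⧸ p ⊔ I ^ n)) :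
    HasGrowthAtMost d fun n => (n + 1) * Module.length A (A ⧸ p ⊔ Ideal.span {x} ⊔ I ^ n) :=
  let ⟨_, hc⟩ := exists_length_quotient_sup_pow_add_le p hx
  h.succ_mul_of_add_le (fun _ _ hkl => length_quotient_anti (sup_le_sup_left
    (Ideal.pow_le_pow_right hkl) _)) hc

variable [IsLocalRing A]

theorem coheight_le_of_hasGrowthAtMost (hI : I ≤ maximalIdeal A) {d : ℕ} {p : PrimeSpectrum A}
    (h : HasGrowthAtMost d fun n => Module.length A (A ⧸ p.asIdeal ⊔ I ^ n)) :
    Order.coheight p ≤ d := by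
  induction d generalizing p with
  | zero =>
    rw [Order.coheight_le_coe_iff]
    intro q hpq
    obtain ⟨x, hxq, hxp⟩ := Set.exists_of_ssubset hpq
    obtain ⟨n, hn, h0⟩ := (hasGrowthAtMost_succ_mul_length_quotient p.asIdeal hxp h).exists_eq_zero
    have hle : p.asIdeal ⊔ Ideal.span {x} ⊔ I ^ n ≤ maximalIdeal A :=
      sup_le (sup_le (le_maximalIdeal p.2.ne_top) ((Ideal.span_singleton_le_iff_mem _).2
        (le_maximalIdeal q.2.ne_top hxq))) ((Ideal.pow_le_self hn).trans hI)
    rw [Module.length_eq_zero_iff, Ideal.Quotient.subsingleton_iff] at h0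
    exact absurd (top_le_iff.1 (h0.ge.trans hle)) (maximalIdeal.isMaximal A).ne_top
  | succ d ih =>
    rw [Order.coheight_le_coe_iff]
    intro q hpq
    obtain ⟨x, hxq, hxp⟩ := Set.exists_of_ssubset hpq
    have hle : p.asIdeal ⊔ Ideal.span {x} ≤ q.asIdeal :=
      sup_le hpq.le ((Ideal.span_singleton_le_iff_mem _).2 hxq)
    have hq := (hasGrowthAtMost_succ_mul_length_quotient p.asIdeal hxp h).of_succ_mul.mono
      fun n => length_quotient_anti (sup_le_sup_right hle (I ^ n))
    exact (ih hq).trans_lt (by exact_mod_cast Nat.lt_succ_self d)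

variable {N : Type*} [AddCommGroup N] [Module A N] [Module.Finite A N] {d : ℕ}

theorem coheight_le_of_mem_associatedPrimes (hI : I ≤ maximalIdeal A)
    (h : HasGrowthAtMost d fun n => Module.length A (N ⧸ (I ^ n • ⊤ : Submodule A N)))
    {p : PrimeSpectrum A} (hp : p.asIdeal ∈ associatedPrimes A N) : Order.coheight p ≤ d := by
  obtain ⟨-, x, hx⟩ := isAssociatedPrime_iff.1 hp
  obtain ⟨c, hc⟩ := exists_comap_toSpanSingleton_pow_smul_le I x
  have hker : LinearMap.ker (LinearMap.toSpanSingleton A N x) = p.asIdeal := by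
    rw [hx]
    ext a
    rw [LinearMap.mem_ker, LinearMap.toSpanSingleton_apply, Submodule.mem_colon_singleton,
      Submodule.mem_bot]
  refine coheight_le_of_hasGrowthAtMost hI ((h.comp_add c).mono fun n => ?_)
  rw [← hker, ← relativeLength_top (I ^ (n + c) • ⊤)]
  calc Module.length A (A ⧸ LinearMap.ker (LinearMap.toSpanSingleton A N x) ⊔ I ^ n)
      ≤ relativeLength ((I ^ (n + c) • (⊤ : Submodule A N)).comap
          (LinearMap.toSpanSingleton A N x)) ⊤ :=
        (length_quotient_anti (hc n)).trans_eq (relativeLength_top _).symm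
    _ = relativeLength (I ^ (n + c) • ⊤)
          (Submodule.map (LinearMap.toSpanSingleton A N x) ⊤) := (relativeLength_map ..).symm
    _ ≤ relativeLength (I ^ (n + c) • ⊤) ⊤ := relativeLength_mono le_top

theorem supportDim_le_of_hasGrowthAtMost (hI : I ≤ maximalIdeal A)
    (h : HasGrowthAtMost d fun n => Module.length A (N ⧸ (I ^ n • ⊤ : Submodule A N))) :
    Module.supportDim A N ≤ d := by
  refine iSup_le fun l => ?_
  obtain ⟨p, hp, hpl⟩ := Ideal.exists_minimalPrimes_le
    (Module.mem_support_iff_of_finite.1 l.head.2)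
  have hpN := Module.associatedPrimes.minimalPrimes_annihilator_subset_associatedPrimes A N hp
  have hl : (l.length : ℕ∞) ≤ d :=
    calc (l.length : ℕ∞) ≤ Order.coheight l.head := Order.length_le_coheight_head
      _ ≤ Order.coheight (l.head : PrimeSpectrum A) :=
          Order.coheight_le_coheight_apply_of_strictMono Subtype.val (fun _ _ h => h) _
      _ ≤ Order.coheight (⟨p, hp.isPrime⟩ : PrimeSpectrum A) := Order.coheight_anti hpl
      _ ≤ d := coheight_le_of_mem_associatedPrimes hI h hpN
  exact_mod_cast hl

end DimensionBound

section IrreducibleSubmodules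

variable {R : Type*} [CommRing R] {M : Type*} [AddCommGroup M] [Module R M]

theorem exists_smul_sub_smul_mem {Q : Submodule R M} (hQ : InfIrred Q) {x y : M} (hx : x ∉ Q)
    (hy : y ∉ Q) : ∃ a b : R, a • x ∉ Q ∧ a • x - b • y ∈ Q := by
  by_contra! h
  have hinf : (Q ⊔ Submodule.span R {x}) ⊓ (Q ⊔ Submodule.span R {y}) = Q := by
    refine le_antisymm ?_ (le_inf le_sup_left le_sup_left)
    rintro z ⟨hzx, hzy⟩
    obtain ⟨q₁, hq₁, _, hx', rfl⟩ := Submodule.mem_sup.1 hzx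
    obtain ⟨q₂, hq₂, _, hy', e⟩ := Submodule.mem_sup.1 hzy
    obtain ⟨a, rfl⟩ := Submodule.mem_span_singleton.1 hx'
    obtain ⟨b, rfl⟩ := Submodule.mem_span_singleton.1 hy'
    refine Q.add_mem hq₁ (by_contra fun hax => h a b hax ?_)
    have : a • x - b • y = q₂ - q₁ := by
      rw [sub_eq_sub_iff_add_eq_add, e, add_comm]
    exact this ▸ Q.sub_mem hq₂ hq₁
  have hmem (z : M) (hz : Q ⊔ Submodule.span R {z} = Q) : z ∈ Q :=
    hz ▸ Submodule.mem_sup_right (Submodule.mem_span_singleton_self z)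
  exact (hQ.2 hinf).elim (fun h => hx (hmem x h)) fun h => hy (hmem y h)

theorem exists_colon_smul_eq_radical_colon [IsNoetherianRing R] {Q : Submodule R M}
    (hQ : Q.IsPrimary) {x : M} (hx : x ∉ Q) :
    ∃ a : R, Q.colon {a • x} = (Q.colon Set.univ).radical := by
  let S := Submodule.span R {x}
  let x' : S := ⟨x, Submodule.mem_span_singleton_self x⟩
  have hcolon (y : S) : (Q.comap S.subtype).colon {y} = Q.colon {(y : M)} := by
    ext r
    simp [Submodule.mem_colon_singleton]
  have hmin : (Q.colon Set.univ).radical ∈ ((Q.comap S.subtype).colon {x'}).minimalPrimes := by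
    have := hQ.isPrime_radical_colon
    rw [hcolon, ← Ideal.radical_minimalPrimes, hQ.radical_colon_singleton_of_notMem hx,
      Ideal.minimalPrimes_eq_subsingleton_self]
    rfl
  obtain ⟨⟨y, hy⟩, h⟩ := Submodule.exists_eq_colon_of_mem_minimalPrimes hmin
  obtain ⟨a, rfl⟩ := Submodule.mem_span_singleton.1 hy
  exact ⟨a, (h.trans (hcolon _)).symm⟩

theorem exists_smul_mem_of_radical_colon_ne {Q : Submodule R M} (hQ : Q.IsPrimary)
    {p : Ideal R} [hp : p.IsPrime] (hne : (Q.colon Set.univ).radical ≠ p) {x : M}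
    (hx : x ∈ moduleColon Q p) : ∃ s ∉ p, s • x ∈ Q := by
  by_contra! h
  have hxQ : x ∉ Q := by simpa using h 1 hp.one_notMem
  have hcolon : Q.colon {x} = p := by
    ext r
    rw [Submodule.mem_colon_singleton]
    exact ⟨not_imp_not.1 (h r), mem_moduleColon.1 hx r⟩
  exact hne (by rw [← hQ.radical_colon_singleton_of_notMem hxQ, hcolon, hp.radical])

theorem exists_smul_sub_smul_mem_of_mem_moduleColon {Q : Submodule R M} (hQ : InfIrred Q)
    {p : Ideal R} [hp : p.IsPrime] {x u : M} (hu : Q.colon {u} = p) (hx : x ∈ moduleColon Q p) :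
    ∃ s ∉ p, ∃ a : R, s • x - a • u ∈ Q := by
  by_cases hxQ : x ∈ Q
  · exact ⟨1, hp.one_notMem, 0, by simpa using hxQ⟩
  · have huQ : u ∉ Q := fun h =>
      hp.one_notMem (hu ▸ Submodule.mem_colon_singleton.2 (Q.smul_mem 1 h))
    obtain ⟨a, b, ha, hab⟩ := exists_smul_sub_smul_mem hQ hxQ huQ
    exact ⟨a, fun h => ha (mem_moduleColon.1 hx a h), b, hab⟩

theorem sum_smul_sub_smul_mem {ι : Type*} [Fintype ι] {Q : Submodule R M} {u : ι → M} {i : ι}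
    (hu : ∀ j ≠ i, u j ∈ Q) (a : ι → R) : ∑ j, a j • u j - a i • u i ∈ Q := by
  classical
  rw [← Finset.sum_erase_eq_sub (Finset.mem_univ i)]
  exact Submodule.sum_mem _ fun j hj => Q.smul_mem _ (hu j (Finset.ne_of_mem_erase hj))

/-- Elements `u i` of `K :_M p` that form a basis of the socle `(K :_M p) / K` after localization
at the prime `p`, expressed without localizing: every relation has coefficients in `p`, and every
element of `K :_M p` has a multiple by some `s ∉ p` in the span of the `u i` modulo `K`. -/
structure IsSocleBasis (p : Ideal R) (K : Submodule R M) {ι : Type*} [Fintype ι] (u : ι → M) :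
    Prop where
  mem : ∀ i, u i ∈ moduleColon K p
  indep : ∀ a : ι → R, ∑ i, a i • u i ∈ K → ∀ i, a i ∈ p
  span : ∀ x ∈ moduleColon K p, ∃ s ∉ p, ∃ a : ι → R, s • x - ∑ i, a i • u i ∈ K

end IrreducibleSubmodules

namespace IsIrredundantIrreducibleDecomposition

variable {R : Type*} [CommRing R] {M : Type*} [AddCommGroup M] [Module R M]
  {K : Submodule R M} {s : Finset (Submodule R M)}

theorem mem_iff (hs : IsIrredundantIrreducibleDecomposition K s) {x : M} :
    x ∈ K ↔ ∀ Q ∈ s, x ∈ Q := by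
  simp [← hs.inf_eq]

theorem exists_notMem_and_forall_mem (hs : IsIrredundantIrreducibleDecomposition K s)
    {Q : Submodule R M} (hQ : Q ∈ s) : ∃ x ∉ Q, ∀ Q' ∈ s, Q' ≠ Q → x ∈ Q' := by
  classical
  by_contra! h
  refine hs.irredundant (s.erase Q) (Finset.erase_ssubset hQ) (le_antisymm (fun x hx => ?_) ?_)
  · have hmem : ∀ Q' ∈ s, Q' ≠ Q → x ∈ Q' := fun Q' hQ' hne => by
      simp only [Submodule.mem_finsetInf, Finset.mem_erase, id] at hx
      exact hx Q' ⟨hne, hQ'⟩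
    refine hs.mem_iff.2 fun Q' hQ' => ?_
    by_contra hxQ'
    obtain rfl : Q' = Q := by_contra fun hne => hxQ' (hmem Q' hQ' hne)
    obtain ⟨Q'', hQ'', hne, hx''⟩ := h x hxQ'
    exact hx'' (hmem Q'' hQ'' hne)
  · exact hs.inf_eq.symm.trans_le (Finset.inf_mono (Finset.erase_subset Q s))

theorem exists_dual_family [IsNoetherianRing R] [Module.Finite R M]
    (hs : IsIrredundantIrreducibleDecomposition K s) :
    ∃ u : Submodule R M → M, ∀ Q ∈ s, Q.colon {u Q} = (Q.colon Set.univ).radical ∧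
      ∀ Q' ∈ s, Q' ≠ Q → u Q ∈ Q' := by
  choose! x hxQ hx using fun Q (hQ : Q ∈ s) => hs.exists_notMem_and_forall_mem hQ
  choose! a ha using fun Q (hQ : Q ∈ s) =>
    exists_colon_smul_eq_radical_colon (hs.infIrred Q hQ).isPrimary (hxQ Q hQ)
  exact ⟨fun Q => a Q • x Q, fun Q hQ =>
    ⟨ha Q hQ, fun Q' hQ' hne => Q'.smul_mem _ (hx Q hQ Q' hQ' hne)⟩⟩

open Classical in
theorem exists_smul_sub_sum_smul_mem [IsNoetherianRing R] [Module.Finite R M]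
    (hs : IsIrredundantIrreducibleDecomposition K s) {p : Ideal R} [hp : p.IsPrime]
    {u : Submodule R M → M} (hu : ∀ Q ∈ s, Q.colon {u Q} = (Q.colon Set.univ).radical ∧
      ∀ Q' ∈ s, Q' ≠ Q → u Q ∈ Q') {x : M} (hx : x ∈ moduleColon K p) :
    ∃ c ∉ p, ∃ a : Submodule R M → R,
      c • x - ∑ Q ∈ s with (Q.colon Set.univ).radical = p, a Q • u Q ∈ K := by
  have hlocal (Q : Submodule R M) (hQ : Q ∈ s) : ∃ c ∉ p, ∃ a : R,
      ((Q.colon Set.univ).radical ≠ p → a = 0) ∧ c • x - a • u Q ∈ Q := by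
    have hxQ : x ∈ moduleColon Q p :=
      mem_moduleColon.2 fun r hr => hs.mem_iff.1 (mem_moduleColon.1 hx r hr) Q hQ
    by_cases hQp : (Q.colon Set.univ).radical = p
    · obtain ⟨c, hc, a, h⟩ := exists_smul_sub_smul_mem_of_mem_moduleColon (hs.infIrred Q hQ)
        ((hu Q hQ).1.trans hQp) hxQ
      exact ⟨c, hc, a, fun hne => absurd hQp hne, h⟩
    · obtain ⟨c, hc, h⟩ := exists_smul_mem_of_radical_colon_ne (hs.infIrred Q hQ).isPrimary hQp hxQ
      exact ⟨c, hc, 0, fun _ => rfl, by simpa using h⟩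
  choose! c hc a ha hca using hlocal
  refine ⟨∏ Q ∈ s, c Q, fun h => ?_, fun Q => (∏ Q' ∈ s.erase Q, c Q') * a Q, ?_⟩
  · obtain ⟨Q, hQ, h⟩ := Ideal.IsPrime.prod_mem_iff.1 h
    exact hc Q hQ h
  rw [hs.mem_iff]
  intro Q hQ
  have hzero : ∀ Q' ∈ s, (Q'.colon Set.univ).radical ≠ p →
      ((∏ Q'' ∈ s.erase Q', c Q'') * a Q') • u Q' = 0 := fun Q' hQ' h => by
    rw [ha Q' hQ' h, mul_zero, zero_smul]
  rw [Finset.sum_filter_of_ne fun Q' hQ' h => not_imp_comm.1 (hzero Q' hQ') h,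
    ← Finset.add_sum_erase s _ hQ, ← sub_sub, ← Finset.prod_erase_mul s c hQ, mul_smul, mul_smul,
    ← smul_sub]
  refine Q.sub_mem (Q.smul_mem _ (hca Q hQ)) (Submodule.sum_mem _ fun Q' hQ' => Q.smul_mem _ ?_)
  exact (hu Q' (Finset.mem_of_mem_erase hQ')).2 Q hQ (Finset.ne_of_mem_erase hQ').symm

open Classical in
theorem exists_isSocleBasis [IsNoetherianRing R] [Module.Finite R M]
    (hs : IsIrredundantIrreducibleDecomposition K s) (p : Ideal R) [p.IsPrime] :
    ∃ u : {Q ∈ s | (Q.colon Set.univ).radical = p} → M, IsSocleBasis p K u := by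
  obtain ⟨u, hu⟩ := hs.exists_dual_family
  have hmem (i : {Q ∈ s | (Q.colon Set.univ).radical = p}) :
      i.1 ∈ s ∧ i.1.colon {u i.1} = p := by
    obtain ⟨his, hip⟩ := Finset.mem_filter.1 i.2
    exact ⟨his, (hu _ his).1.trans hip⟩
  refine ⟨fun i => u i.1, fun i => mem_moduleColon.2 fun r hr => hs.mem_iff.2 fun Q hQ => ?_,
    fun a ha i => ?_, fun x hx => ?_⟩
  · by_cases hQi : Q = i.1
    · rw [hQi, ← Submodule.mem_colon_singleton, (hmem i).2]
      exact hr
    · exact Q.smul_mem _ ((hu _ (hmem i).1).2 Q hQ hQi)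
  · rw [← (hmem i).2, Submodule.mem_colon_singleton,
      ← Submodule.sub_mem_iff_right _ (hs.mem_iff.1 ha i.1 (hmem i).1)]
    exact sum_smul_sub_smul_mem (fun j hj =>
      (hu _ (hmem j).1).2 _ (hmem i).1 fun h => hj (Subtype.ext h.symm)) a
  · obtain ⟨c, hc, a, h⟩ := hs.exists_smul_sub_sum_smul_mem hu hx
    refine ⟨c, hc, fun i => a i.1, ?_⟩
    rwa [Finset.sum_coe_sort _ fun Q => a Q • u Q]

end IsIrredundantIrreducibleDecomposition

section LocalizedSocle

variable {R : Type*} [CommRing R] {M : Type*} [AddCommGroup M] [Module R M]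
  {p : Ideal R} [p.IsPrime] {K : Submodule R M}

theorem mkLinearMap_mem_localized {x : M} :
    LocalizedModule.mkLinearMap p.primeCompl M x ∈ K.localized p.primeCompl ↔
      ∃ s ∉ p, s • x ∈ K := by
  rw [Submodule.mem_localized']
  constructor
  · rintro ⟨m, hm, s, h⟩
    rw [IsLocalizedModule.mk'_eq_iff, Submonoid.smul_def, ← map_smul,
      IsLocalizedModule.eq_iff_exists p.primeCompl] at h
    obtain ⟨c, hc⟩ := h
    simp only [Submonoid.smul_def] at hc
    exact ⟨c * s, (c * s).2, by rw [mul_smul, ← hc]; exact K.smul_mem _ hm⟩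
  · rintro ⟨s, hs, h⟩
    exact ⟨s • x, h, ⟨s, hs⟩, by
      rw [IsLocalizedModule.mk'_eq_iff, Submonoid.smul_def, map_smul]⟩

theorem mem_moduleColon_maximalIdeal
    {L : Submodule (Localization.AtPrime p) (LocalizedModule p.primeCompl M)}
    {y : LocalizedModule p.primeCompl M} :
    y ∈ moduleColon L (maximalIdeal (Localization.AtPrime p)) ↔ ∀ r ∈ p, r • y ∈ L := by
  rw [← Localization.AtPrime.map_eq_maximalIdeal, Ideal.map, mem_moduleColon_span]
  simp

theorem exists_smul_mem_moduleColon (hp : p.FG) {x : M}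
    (hx : LocalizedModule.mkLinearMap p.primeCompl M x ∈
      moduleColon (K.localized p.primeCompl) (maximalIdeal (Localization.AtPrime p))) :
    ∃ s ∉ p, s • x ∈ moduleColon K p := by
  classical
  simp_rw [mem_moduleColon_maximalIdeal, ← map_smul, mkLinearMap_mem_localized] at hx
  choose! s hs hsx using hx
  obtain ⟨G, hG⟩ := hp
  have hGp (g : R) (hg : g ∈ G) : g ∈ p := hG ▸ Ideal.subset_span hg
  refine ⟨∏ g ∈ G, s g, fun h => ?_, ?_⟩
  · obtain ⟨g, hg, h⟩ := Ideal.IsPrime.prod_mem_iff.1 h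
    exact hs g (hGp g hg) h
  · rw [← hG, mem_moduleColon_span]
    intro g hg
    rw [← Finset.prod_erase_mul G s hg, mul_smul, smul_comm g, smul_comm g]
    exact K.smul_mem _ (hsx g (hGp g hg))

theorem moduleColon_localized (hp : p.FG) (K : Submodule R M) :
    moduleColon (K.localized p.primeCompl) (maximalIdeal (Localization.AtPrime p)) =
      (moduleColon K p).localized p.primeCompl := by
  let f := LocalizedModule.mkLinearMap p.primeCompl M
  apply le_antisymm
  · intro y hy
    obtain ⟨⟨x, s⟩, hxs : s • y = f x⟩ := IsLocalizedModule.surj p.primeCompl f y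
    have hx : f x ∈ moduleColon (K.localized p.primeCompl)
        (maximalIdeal (Localization.AtPrime p)) := by
      rw [← hxs]
      exact Submodule.smul_of_tower_mem _ s hy
    obtain ⟨t, ht, htx⟩ := exists_smul_mem_moduleColon hp hx
    refine (Submodule.mem_localized' ..).2 ⟨t • x, htx, ⟨t, ht⟩ * s, ?_⟩
    rw [IsLocalizedModule.mk'_eq_iff, mul_smul, hxs, map_smul, Submonoid.smul_def]
  · rw [Submodule.localized, Submodule.localized'_eq_span, Submodule.span_le]
    rintro _ ⟨x, hx, rfl⟩
    refine mem_moduleColon_maximalIdeal.2 fun r hr => ?_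
    rw [← map_smul]
    exact mkLinearMap_mem_localized.2 ⟨1, p.one_notMem, by
      rw [one_smul]
      exact mem_moduleColon.1 hx r hr⟩

end LocalizedSocle

namespace IsSocleBasis

variable {R : Type*} [CommRing R] {M : Type*} [AddCommGroup M] [Module R M]
  {p : Ideal R} [p.IsPrime] {K : Submodule R M} {ι : Type*} [Fintype ι] {u : ι → M}

theorem linearCombination_algebraMap (u : ι → M) (a : ι → R) :
    Fintype.linearCombination (Localization.AtPrime p)
        (fun i => LocalizedModule.mkLinearMap p.primeCompl M (u i))
        (fun i => algebraMap R (Localization.AtPrime p) (a i)) =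
      LocalizedModule.mkLinearMap p.primeCompl M (∑ i, a i • u i) := by
  simp [Fintype.linearCombination_apply]

theorem mem_maximalIdeal_of_linearCombination_mem (hu : IsSocleBasis p K u)
    {e : ι → Localization.AtPrime p}
    (he : Fintype.linearCombination (Localization.AtPrime p)
      (fun i => LocalizedModule.mkLinearMap p.primeCompl M (u i)) e ∈ K.localized p.primeCompl)
    (i : ι) : e i ∈ maximalIdeal (Localization.AtPrime p) := by
  obtain ⟨b, hb⟩ := IsLocalization.exist_integer_multiples_of_finite p.primeCompl e
  choose a ha using hb
  have hmem : LocalizedModule.mkLinearMap p.primeCompl M (∑ i, a i • u i) ∈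
      K.localized p.primeCompl := by
    rw [← linearCombination_algebraMap, funext ha]
    change Fintype.linearCombination _ _ (b • e) ∈ _
    rw [LinearMap.map_smul_of_tower]
    exact Submodule.smul_of_tower_mem _ b he
  obtain ⟨s, hs, hsK⟩ := mkLinearMap_mem_localized.1 hmem
  simp_rw [Finset.smul_sum, smul_smul] at hsK
  have hap : a i ∈ p := (Ideal.IsPrime.mem_or_mem ‹_› (hu.indep _ hsK i)).resolve_left hs
  have hae : (b : R) • e i ∈ maximalIdeal (Localization.AtPrime p) := by
    rw [← ha, ← Localization.AtPrime.map_eq_maximalIdeal]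
    exact Ideal.mem_map_of_mem _ hap
  rw [Algebra.smul_def] at hae
  exact (Ideal.unit_mul_mem_iff_mem _ (IsLocalization.map_units _ b)).1 hae

theorem comap_linearCombination (hp : p.FG) (hu : IsSocleBasis p K u) :
    (K.localized p.primeCompl).comap (Fintype.linearCombination (Localization.AtPrime p)
        fun i => LocalizedModule.mkLinearMap p.primeCompl M (u i)) =
      Submodule.pi Set.univ fun _ => maximalIdeal (Localization.AtPrime p) := by
  refine le_antisymm (fun e he i _ => hu.mem_maximalIdeal_of_linearCombination_mem he i)
    fun e he => ?_
  rw [Submodule.mem_comap, Fintype.linearCombination_apply]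
  refine Submodule.sum_mem _ fun i _ => ?_
  have hui : LocalizedModule.mkLinearMap p.primeCompl M (u i) ∈
      moduleColon (K.localized p.primeCompl) (maximalIdeal (Localization.AtPrime p)) := by
    rw [moduleColon_localized hp]
    exact mkLinearMap_mem_localized.2 ⟨1, p.one_notMem, by simpa using hu.mem i⟩
  exact mem_moduleColon.1 hui _ (he i trivial)

theorem range_linearCombination_sup (hp : p.FG) (hu : IsSocleBasis p K u) :
    LinearMap.range (Fintype.linearCombination (Localization.AtPrime p)
        fun i => LocalizedModule.mkLinearMap p.primeCompl M (u i)) ⊔ K.localized p.primeCompl =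
      moduleColon (K.localized p.primeCompl) (maximalIdeal (Localization.AtPrime p)) := by
  let f := LocalizedModule.mkLinearMap p.primeCompl M
  rw [moduleColon_localized hp, Fintype.range_linearCombination]
  have hmem {L : Submodule R M} {x : M} (hx : x ∈ L) : f x ∈ L.localized p.primeCompl :=
    mkLinearMap_mem_localized.2 ⟨1, p.one_notMem, by rwa [one_smul]⟩
  apply le_antisymm
  · refine sup_le (Submodule.span_le.2 ?_) ?_
    · rintro _ ⟨i, rfl⟩
      exact hmem (hu.mem i)
    · exact (Submodule.localized'gi _ _ f).gc.monotone_l (le_moduleColon K p)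
  · refine (Submodule.localized'_eq_span ..).trans_le (Submodule.span_le.2 ?_)
    rintro _ ⟨x, hx, rfl⟩
    obtain ⟨c, hc, a, h⟩ := hu.span x hx
    have hunit : IsUnit (algebraMap R (Localization.AtPrime p) c) :=
      IsLocalization.map_units _ (⟨c, hc⟩ : p.primeCompl)
    rw [SetLike.mem_coe, ← Submodule.smul_mem_iff_of_isUnit _ hunit, algebraMap_smul, ← map_smul,
      ← sub_add_cancel (c • x) (∑ i, a i • u i), map_add]
    refine add_mem (Submodule.mem_sup_right (hmem h)) (Submodule.mem_sup_left ?_)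
    rw [← Fintype.range_linearCombination]
    exact ⟨_, linearCombination_algebraMap u a⟩

end IsSocleBasis

section IndexOfReducibility

variable {R : Type*} [CommRing R] [IsNoetherianRing R] {M : Type*} [AddCommGroup M] [Module R M]

/-- The length of the socle `(K_𝔭 : 𝔭) / K_𝔭` of the localization of `M ⧸ K` at `𝔭`. -/
noncomputable def socleLengthAt (p : PrimeSpectrum R) (K : Submodule R M) : ℕ∞ :=
  relativeLength (K.localized p.asIdeal.primeCompl)
    (moduleColon (K.localized p.asIdeal.primeCompl)
      (maximalIdeal (Localization.AtPrime p.asIdeal)))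

theorem IsSocleBasis.socleLengthAt_eq {p : PrimeSpectrum R} {K : Submodule R M} {ι : Type*}
    [Fintype ι] {u : ι → M} (hu : IsSocleBasis p.asIdeal K u) :
    socleLengthAt p K = Fintype.card ι := by
  classical
  have hp : p.asIdeal.FG := IsNoetherian.noetherian _
  rw [socleLengthAt, ← hu.range_linearCombination_sup hp, relativeLength_sup,
    LinearMap.range_eq_map, relativeLength_map, hu.comap_linearCombination hp, relativeLength_top,
    (Submodule.quotientPi _).length_eq, Module.length_pi_of_fintype]
  simp_rw [length_quotient_maximalIdeal]
  simp

theorem IsSocleBasis.mem_associatedPrimes {p : Ideal R} [hp : p.IsPrime] {K : Submodule R M}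
    {ι : Type*} [Fintype ι] {u : ι → M} (hu : IsSocleBasis p K u) (i : ι) :
    p ∈ associatedPrimes R (M ⧸ K) := by
  classical
  refine isAssociatedPrime_iff.2 ⟨hp, K.mkQ (u i), ?_⟩
  ext r
  rw [Submodule.mem_colon_singleton, ← map_smul, Submodule.mem_bot, Submodule.mkQ_apply,
    Submodule.Quotient.mk_eq_zero]
  refine ⟨mem_moduleColon.1 (hu.mem i) r, fun h => ?_⟩
  simpa using hu.indep (Pi.single i r) (by simpa [Pi.single_apply] using h) i

open Classical in
theorem IsIrredundantIrreducibleDecomposition.socleLengthAt_eq_card [Module.Finite R M]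
    {K : Submodule R M} {s : Finset (Submodule R M)}
    (hs : IsIrredundantIrreducibleDecomposition K s) (p : PrimeSpectrum R) :
    socleLengthAt p K = ({Q ∈ s | (Q.colon Set.univ).radical = p.asIdeal} : Finset _).card := by
  obtain ⟨u, hu⟩ := hs.exists_isSocleBasis p.asIdeal
  rw [hu.socleLengthAt_eq, Fintype.card_coe]

theorem mem_associatedPrimes_of_socleLengthAt_ne_zero [Module.Finite R M]
    {p : PrimeSpectrum R} {K : Submodule R M} (h : socleLengthAt p K ≠ 0) :
    p.asIdeal ∈ associatedPrimes R (M ⧸ K) := by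
  classical
  obtain ⟨s, hs⟩ := exists_isIrredundantIrreducibleDecomposition K
  obtain ⟨u, hu⟩ := hs.exists_isSocleBasis p.asIdeal
  rw [hu.socleLengthAt_eq, Nat.cast_ne_zero] at h
  obtain ⟨i⟩ := Fintype.card_pos_iff.1 (Nat.pos_of_ne_zero h)
  exact hu.mem_associatedPrimes i

theorem indexOfReducibility_eq_sum_socleLengthAt [Module.Finite R M]
    (K : Submodule R M) (T : Finset (PrimeSpectrum R))
    (hT : ∀ p : PrimeSpectrum R, p.asIdeal ∈ associatedPrimes R (M ⧸ K) → p ∈ T) :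
    (indexOfReducibility K : ℕ∞) = ∑ p ∈ T, socleLengthAt p K := by
  classical
  obtain ⟨s, hs⟩ := exists_isIrredundantIrreducibleDecomposition K
  have hmem : ∀ Q ∈ s, ∃ p ∈ T, (Q.colon Set.univ).radical = p.asIdeal := fun Q hQ => by
    have hp := (hs.infIrred Q hQ).isPrimary.isPrime_radical_colon
    obtain ⟨u, hu⟩ := hs.exists_isSocleBasis (Q.colon Set.univ).radical
    exact ⟨⟨_, hp⟩, hT ⟨_, hp⟩ (hu.mem_associatedPrimes ⟨Q, Finset.mem_filter.2 ⟨hQ, rfl⟩⟩), rfl⟩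
  have hs_eq : s = T.biUnion fun p => {Q ∈ s | (Q.colon Set.univ).radical = p.asIdeal} := by
    ext Q
    simp only [Finset.mem_biUnion, Finset.mem_filter]
    exact ⟨fun hQ => (hmem Q hQ).imp fun _ h => ⟨h.1, hQ, h.2⟩, fun ⟨_, _, hQ, _⟩ => hQ⟩
  rw [indexOfReducibility_eq_card hs]
  conv_lhs => rw [hs_eq]
  rw [Finset.card_biUnion fun p _ q _ hpq => ?_, Nat.cast_sum]
  · exact Finset.sum_congr rfl fun p _ => (hs.socleLengthAt_eq_card p).symm
  · exact Finset.disjoint_filter.2 fun Q _ hp hq => hpq (PrimeSpectrum.ext (hp.symm.trans hq))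

end IndexOfReducibility

section AssociatedPrimes

theorem associatedPrimes_subset_image_comap (R S W : Type*) [CommRing R] [CommRing S] [Algebra R S]
    [IsNoetherianRing S] [AddCommGroup W] [Module R W] [Module S W] [IsScalarTower R S W] :
    associatedPrimes R W ⊆ Ideal.comap (algebraMap R S) '' associatedPrimes S W := by
  rintro p ⟨hp, w, hw⟩
  have hcolon : (Submodule.colon (⊥ : Submodule R W) {w}) =
      (Submodule.colon (⊥ : Submodule S W) {w}).comap (algebraMap R S) := by
    ext r
    simp only [Ideal.mem_comap, Submodule.mem_colon_singleton, Submodule.mem_bot, algebraMap_smul]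
  have hmin : p ∈ ((Submodule.colon (⊥ : Submodule S W) {w}).comap
      (algebraMap R S)).minimalPrimes := by
    rw [← hcolon, ← Ideal.radical_minimalPrimes, ← hw, Ideal.minimalPrimes_eq_subsingleton_self]
    rfl
  obtain ⟨q, hq, rfl⟩ := Ideal.exists_minimalPrimes_comap_eq _ p hmin
  exact ⟨q, isAssociatedPrime_iff.2
    ⟨hq.isPrime, Submodule.exists_eq_colon_of_mem_minimalPrimes hq⟩, rfl⟩

theorem finite_associatedPrimes_of_finite (R S W : Type*) [CommRing R] [CommRing S] [Algebra R S]
    [IsNoetherianRing S] [AddCommGroup W] [Module R W] [Module S W] [IsScalarTower R S W]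
    [Module.Finite S W] : (associatedPrimes R W).Finite :=
  ((associatedPrimes.finite S W).image _).subset (associatedPrimes_subset_image_comap R S W)

variable {R : Type*} [CommRing R] {M : Type*} [AddCommGroup M] [Module R M]

theorem associatedPrimes_quotient_subset_union {F G : Submodule R M} (hGF : G ≤ F) {W : Type*}
    [AddCommGroup W] [Module R W] (f : F →ₗ[R] W) (hf : LinearMap.ker f = G.comap F.subtype) :
    associatedPrimes R (M ⧸ G) ⊆ associatedPrimes R W ∪ associatedPrimes R (M ⧸ F) := by
  have hi : Function.Injective ((G.comap F.subtype).mapQ G F.subtype le_rfl) := by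
    rw [← LinearMap.ker_eq_bot, Submodule.mapQ, Submodule.ker_liftQ, LinearMap.ker_comp,
      Submodule.ker_mkQ]
    exact Submodule.mkQ_map_self _
  have hif : Function.Exact ((G.comap F.subtype).mapQ G F.subtype le_rfl)
      (Submodule.factor hGF) := by
    rw [LinearMap.exact_iff, Submodule.range_mapQ, Submodule.range_subtype, Submodule.factor,
      Submodule.mapQ, Submodule.ker_liftQ, LinearMap.comp_id, Submodule.ker_mkQ]
  refine (associatedPrimes.subset_union_of_exact hi hif).trans
    (Set.union_subset_union_left _ (associatedPrimes.subset_of_injective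
      (f := (G.comap F.subtype).liftQ f hf.ge) ?_))
  rw [← LinearMap.ker_eq_bot, Submodule.ker_liftQ, hf, Submodule.mkQ_map_self]

variable [IsNoetherianRing R] [Module.Finite R M]

theorem exists_finset_associatedPrimes (I : Ideal R) :
    ∃ T : Finset (PrimeSpectrum R), ∀ (n : ℕ) (p : PrimeSpectrum R),
      p.asIdeal ∈ associatedPrimes R (M ⧸ (I ^ n • ⊤ : Submodule R M)) → p ∈ T := by
  let F := I.stableFiltration (⊤ : Submodule R M)
  let K := (shiftFiltration 1 F).submodule
  let W := F.submodule.map K.mkQ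
  have : Module.Finite (reesAlgebra I) W :=
    Module.Finite.iff_fg.2 ((stableFiltration_submodule_fg I (⊤ : Submodule R M)).map _)
  have hW : (associatedPrimes R W).Finite := finite_associatedPrimes_of_finite R (reesAlgebra I) W
  have hfin : {p : PrimeSpectrum R | p.asIdeal ∈ associatedPrimes R W}.Finite :=
    hW.preimage fun p _ q _ h => PrimeSpectrum.ext h
  refine ⟨hfin.toFinset, fun n p hp => hfin.mem_toFinset.2 ?_⟩
  induction n with
  | zero =>
    have : Subsingleton (M ⧸ (I ^ 0 • ⊤ : Submodule R M)) := by simp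
    simp [associatedPrimes.eq_empty_of_subsingleton] at hp
  | succ n ih =>
    let f : F.N n →ₗ[R] W.restrictScalars R :=
      (K.mkQ.restrictScalars R ∘ₗ PolynomialModule.lsingle R n).restrict fun _ hx =>
        Submodule.mem_map_of_mem (single_mem_filtration_submodule.2 hx)
    have hf : LinearMap.ker f = (F.N (n + 1)).comap (F.N n).subtype := by
      ext x
      rw [LinearMap.mem_ker, ← Submodule.coe_eq_zero]
      exact (Submodule.Quotient.mk_eq_zero K).trans single_mem_filtration_submodule
    exact (associatedPrimes_quotient_subset_union (F.mono n) f hf hp).elim id ih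

end AssociatedPrimes

section LocalBounds

variable {A : Type*} [CommRing A] {N : Type*} [AddCommGroup N] [Module A N] {I : Ideal A}

theorem length_quotient_pow_smul_top (I : Ideal A) (n : ℕ) :
    Module.length A (N ⧸ (I ^ n • ⊤ : Submodule A N)) =
      ∑ k ∈ Finset.range n, relativeLength (I ^ (k + 1) • ⊤) (I ^ k • ⊤ : Submodule A N) := by
  rw [← relativeLength_top]
  induction n with
  | zero => simp [relativeLength_eq_zero_iff]
  | succ n ih =>
    rw [relativeLength_eq_add (Submodule.smul_mono_left (Ideal.pow_le_pow_right n.le_succ)) le_top,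
      ih, Finset.sum_range_succ, add_comm]

theorem smul_pow_smul_top_le {J : Ideal A} (h : J • (⊤ : Submodule A N) ≤ I • ⊤) (n : ℕ) :
    J • I ^ n • (⊤ : Submodule A N) ≤ I ^ (n + 1) • ⊤ := by
  rw [smul_comm, pow_succ, Submodule.mul_smul]
  exact smul_mono_right _ h

theorem pow_smul_top_le {J : Ideal A} (h : J • (⊤ : Submodule A N) ≤ I • ⊤) (n : ℕ) :
    J ^ n • (⊤ : Submodule A N) ≤ I ^ n • ⊤ := by
  induction n with
  | zero => simp
  | succ n ih =>
    rw [pow_succ', Submodule.mul_smul]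
    exact (smul_mono_right _ ih).trans (smul_pow_smul_top_le h n)

variable [IsNoetherianRing A] [IsLocalRing A] [Module.Finite A N] {P : ℚ[X]}
  (hI : I ≤ maximalIdeal A) {s : ℕ} (hs : maximalIdeal A ^ s • (⊤ : Submodule A N) ≤ I • ⊤)
  (hP : EventuallyEval P fun n =>
    relativeLength (I ^ n • ⊤) (moduleColon (I ^ n • ⊤ : Submodule A N) (maximalIdeal A)))

include hI hs hP

theorem ne_zero_of_eventuallyEval_socle [Nontrivial N] : P ≠ 0 := by
  refine hP.ne_zero ((eventually_ge_atTop 1).mono fun n hn hzero => ?_)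
  obtain ⟨c, hc⟩ := exists_relativeLength_le_mul_socle (A := A) (N := N) (s * n)
  have hle := hc (I ^ n • ⊤) ⊤ le_top (by rw [pow_mul]; exact pow_smul_top_le hs n)
  rw [hzero, mul_zero, nonpos_iff_eq_zero, relativeLength_eq_zero_iff] at hle
  exact maximalIdeal_smul_top_ne_top (top_unique (hle.trans
    (Submodule.smul_mono_left ((Ideal.pow_le_self (by lia)).trans hI))))

theorem supportDim_le_natDegree_add_one : Module.supportDim A N ≤ (P.natDegree + 1 : ℕ) := by
  obtain ⟨c, hc⟩ := exists_relativeLength_le_mul_socle (A := A) (N := N) s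
  have hgrowth := hP.hasGrowthAtMost_natDegree
    fun n => relativeLength_ne_top_of_smul_le (smul_moduleColon_le _ _)
  refine supportDim_le_of_hasGrowthAtMost hI
    (((hgrowth.comp_add 1).const_mul c).sum_range.mono fun n => ?_)
  rw [length_quotient_pow_smul_top]
  exact Finset.sum_le_sum fun k _ => hc _ _
    (Submodule.smul_mono_left (Ideal.pow_le_pow_right k.le_succ)) (smul_pow_smul_top_le hs k)

omit hI hs

theorem degree_lt_of_hasGrowthAtMost_sum_card {d : ℕ} {g : ℕ → ℕ}
    (hU : ∀ n, ∃ U : Finset N, Submodule.span A (U : Set N) = I ^ n • ⊤ ∧ U.card ≤ g n)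
    (hg : HasGrowthAtMost d fun n => ∑ k ∈ Finset.range n, (g k : ℕ∞)) :
    P.degree < (max d 1 : ℕ) := by
  obtain ⟨c, b, D, hD, hsocle⟩ := exists_relativeLength_socle_le_add (N := N) I
  obtain ⟨a, ha⟩ := exists_relativeLength_le_card_mul I D c hD
  have hle : ∀ n, relativeLength (I ^ (n + c) • ⊤)
      (moduleColon (I ^ (n + c) • ⊤ : Submodule A N) (maximalIdeal A)) ≤ a * g n + b := by
    intro n
    obtain ⟨U, hU, hUg⟩ := hU n
    refine (hsocle n).trans ?_
    gcongr
    refine (ha n U hU).trans ?_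
    gcongr
  refine hP.degree_lt_of_hasGrowthAtMost_sum_range (.sum_range_of_comp_add (c := c)
    (fun n => relativeLength_ne_top_of_smul_le (smul_moduleColon_le _ _)) (.mono
      (((hg.const_mul a).mono_exponent (le_max_left d 1)).add
        ((HasGrowthAtMost.const b).sum_range.mono_exponent (le_max_right d 1))) fun n => ?_))
  rw [Finset.mul_sum, ← Finset.sum_add_distrib]
  exact Finset.sum_le_sum fun k _ => hle k

end LocalBounds

section Degree

variable {P Q : ℚ[X]}

theorem map_degree_add_one (h : P ≠ 0) :
    P.degree.map (Nat.cast : ℕ → ℕ∞) + 1 = (P.natDegree + 1 : ℕ) := by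
  rw [degree_eq_natDegree h]
  rfl

theorem map_degree_add_one_mono (h : P.degree ≤ Q.degree) :
    P.degree.map (Nat.cast : ℕ → ℕ∞) + 1 ≤ Q.degree.map (Nat.cast : ℕ → ℕ∞) + 1 :=
  add_le_add_left (Nat.mono_cast.withBot_map h) 1

theorem map_degree_add_one_le_of_degree_lt {n : ℕ} (h : P.degree < n) :
    P.degree.map (Nat.cast : ℕ → ℕ∞) + 1 ≤ n := by
  rcases eq_or_ne P 0 with rfl | h0
  · exact bot_le
  · rw [map_degree_add_one h0]
    exact_mod_cast (natDegree_lt_iff_degree_lt h0).2 h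

theorem map_degree_sum_add_one_le {ι : Type*} {s : Finset ι} {P : ι → ℚ[X]} {a : WithBot ℕ∞}
    (h : ∀ i ∈ s, (P i).degree.map (Nat.cast : ℕ → ℕ∞) + 1 ≤ a) :
    (∑ i ∈ s, P i).degree.map (Nat.cast : ℕ → ℕ∞) + 1 ≤ a := by
  rcases s.eq_empty_or_nonempty with rfl | hs
  · exact bot_le
  · obtain ⟨i, hi, hsup⟩ := s.exists_mem_eq_sup hs fun i => (P i).degree
    exact (map_degree_add_one_mono ((degree_sum_le s P).trans hsup.le)).trans (h i hi)

end Degree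

section Localization

variable {R : Type*} [CommRing R] {M : Type*} [AddCommGroup M] [Module R M]

theorem localized_mono (p : Ideal R) [p.IsPrime] {K L : Submodule R M} (h : K ≤ L) :
    K.localized p.primeCompl ≤ L.localized p.primeCompl :=
  (Submodule.localized'gi (Localization.AtPrime p) p.primeCompl
    (LocalizedModule.mkLinearMap p.primeCompl M)).gc.monotone_l h

theorem localized_smul_top (p I : Ideal R) [p.IsPrime] :
    (I • ⊤ : Submodule R M).localized p.primeCompl =
      I.map (algebraMap R (Localization.AtPrime p)) • ⊤ := by
  rw [Submodule.localized, Submodule.localized'_smul, Submodule.localized'_top,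
    Ideal.localized'_eq_map]

theorem localized_pow_smul_top (p I : Ideal R) [p.IsPrime] (n : ℕ) :
    (I ^ n • ⊤ : Submodule R M).localized p.primeCompl =
      I.map (algebraMap R (Localization.AtPrime p)) ^ n • ⊤ := by
  rw [localized_smul_top, Ideal.map_pow]

theorem localized_le_localized_of_le {p m : Ideal R} [p.IsPrime] [m.IsPrime] (hpm : p ≤ m)
    {K L : Submodule R M} (h : K.localized m.primeCompl ≤ L.localized m.primeCompl) :
    K.localized p.primeCompl ≤ L.localized p.primeCompl := by
  refine (Submodule.localized'_eq_span ..).trans_le (Submodule.span_le.2 ?_)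
  rintro _ ⟨x, hx, rfl⟩
  obtain ⟨s, hs, hsx⟩ := mkLinearMap_mem_localized.1
    (h (mkLinearMap_mem_localized.2 ⟨1, m.one_notMem, by rwa [one_smul]⟩))
  exact mkLinearMap_mem_localized.2 ⟨s, fun hsp => hs (hpm hsp), hsx⟩

theorem exists_finset_localized_span_eq (m : Ideal R) [m.IsPrime] {K : Submodule R M}
    (hK : K.FG) :
    ∃ V : Finset M, V.card ≤ (K.localized m.primeCompl).spanFinrank ∧
      Submodule.span R (V : Set M) ≤ K ∧
      K.localized m.primeCompl ≤ (Submodule.span R (V : Set M)).localized m.primeCompl := by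
  classical
  obtain ⟨W, hW, hspan⟩ := (K.localized_fg m.primeCompl hK).exists_span_finset_card_eq_spanFinrank
  have hWK : ∀ w ∈ W, ∃ x ∈ K, ∃ s : m.primeCompl,
      IsLocalizedModule.mk' (LocalizedModule.mkLinearMap m.primeCompl M) x s = w := fun w hw =>
    (Submodule.mem_localized' (Localization.AtPrime m) ..).1 (hspan.le (Submodule.subset_span hw))
  choose! x hx s hs using hWK
  refine ⟨W.image x, Finset.card_image_le.trans hW.le, Submodule.span_le.2 fun y hy => ?_, ?_⟩
  · obtain ⟨w, hw, rfl⟩ := Finset.mem_image.1 hy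
    exact hx w hw
  · refine hspan.ge.trans (Submodule.span_le.2 fun w hw => ?_)
    exact (Submodule.mem_localized' ..).2
      ⟨x w, Submodule.subset_span (Finset.mem_image_of_mem x hw), s w, hs w hw⟩

theorem exists_span_eq_localized_card_le {p m : Ideal R} [p.IsPrime] [m.IsPrime] (hpm : p ≤ m)
    {K : Submodule R M} (hK : K.FG) :
    ∃ U : Finset (LocalizedModule p.primeCompl M),
      Submodule.span (Localization.AtPrime p) (U : Set (LocalizedModule p.primeCompl M)) =
        K.localized p.primeCompl ∧ U.card ≤ (K.localized m.primeCompl).spanFinrank := by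
  classical
  obtain ⟨V, hV, hle, hge⟩ := exists_finset_localized_span_eq m hK
  refine ⟨V.image (LocalizedModule.mkLinearMap p.primeCompl M), ?_, Finset.card_image_le.trans hV⟩
  rw [Finset.coe_image, ← Submodule.localized'_span (Localization.AtPrime p) p.primeCompl]
  exact le_antisymm (localized_mono p hle) (localized_le_localized_of_le hpm hge)

theorem map_le_maximalIdeal {I p : Ideal R} [p.IsPrime] (h : I ≤ p) :
    I.map (algebraMap R (Localization.AtPrime p)) ≤
      maximalIdeal (Localization.AtPrime p) :=
  (Ideal.map_mono h).trans_eq Localization.AtPrime.map_eq_maximalIdeal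

end Localization

section AssociatedPrimesLocalization

variable {R : Type*} [CommRing R] {M : Type*} [AddCommGroup M] [Module R M]
  {I p : Ideal R}

theorem le_of_mem_associatedPrimes {n : ℕ}
    (hp : p ∈ associatedPrimes R (M ⧸ (I ^ n • ⊤ : Submodule R M))) : I ≤ p := by
  have := IsAssociatedPrime.isPrime hp
  have hann := IsAssociatedPrime.annihilator_le hp
  rw [Submodule.annihilator_top] at hann
  exact Ideal.IsPrime.le_of_pow_le ((le_annihilator_quotient_smul_top (I ^ n)).trans hann)

variable [IsNoetherianRing R]

theorem nontrivial_localizedModule_of_mem_associatedPrimes {m : Ideal R} [m.IsPrime] (hpm : p ≤ m)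
    {K : Submodule R M} (hp : p ∈ associatedPrimes R (M ⧸ K)) :
    Nontrivial (LocalizedModule m.primeCompl M) := by
  by_contra h
  rw [not_nontrivial_iff_subsingleton, LocalizedModule.subsingleton_iff] at h
  obtain ⟨-, y, hy⟩ := isAssociatedPrime_iff.1 hp
  obtain ⟨y, rfl⟩ := K.mkQ_surjective y
  obtain ⟨s, hs, hsy⟩ := h y
  refine hs (hpm ?_)
  rw [hy, Submodule.mem_colon_singleton, ← map_smul, hsy, map_zero]
  exact Submodule.zero_mem _

theorem mem_minimalPrimes_annihilator_of_minimal {W : Type*} [AddCommGroup W] [Module R W]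
    [Module.Finite R W] (hp : Minimal (· ∈ associatedPrimes R W) p) :
    p ∈ (Module.annihilator R W).minimalPrimes := by
  have := IsAssociatedPrime.isPrime hp.1
  obtain ⟨q, hq, hqp⟩ := Ideal.exists_minimalPrimes_le (IsAssociatedPrime.annihilator_le hp.1)
  rw [Submodule.annihilator_top] at hq
  have hqW : q ∈ associatedPrimes R W :=
    Module.associatedPrimes.minimalPrimes_annihilator_subset_associatedPrimes R W hq
  rwa [← le_antisymm hqp (hp.2 hqW hqp)]

theorem exists_pow_maximalIdeal_smul_top_le [Module.Finite R M] [p.IsPrime]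
    (hp : Minimal (· ∈ associatedPrimes R (M ⧸ (I • ⊤ : Submodule R M))) p) :
    ∃ s, maximalIdeal (Localization.AtPrime p) ^ s •
      (⊤ : Submodule (Localization.AtPrime p) (LocalizedModule p.primeCompl M)) ≤
        I.map (algebraMap R (Localization.AtPrime p)) • ⊤ := by
  let J := Module.annihilator R (M ⧸ (I • ⊤ : Submodule R M))
  have hle : J • (⊤ : Submodule R M) ≤ I • ⊤ := annihilator_quotient_smul_top_le _
  have hrad := IsLocalization.AtPrime.radical_map_of_mem_minimalPrimes
    (A := Localization.AtPrime p) p J (mem_minimalPrimes_annihilator_of_minimal hp)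
  rw [Localization.AtPrime.map_eq_maximalIdeal] at hrad
  obtain ⟨s, hs⟩ := Ideal.exists_pow_le_of_le_radical_of_fg hrad.ge (IsNoetherian.noetherian _)
  refine ⟨s, (Submodule.smul_mono_left hs).trans ?_⟩
  simpa only [localized_smul_top] using localized_mono p hle

end AssociatedPrimesLocalization

section SocleLengthPolynomial

variable {R : Type*} [CommRing R] [IsNoetherianRing R] {M : Type*} [AddCommGroup M] [Module R M]
  [Module.Finite R M] {I : Ideal R} {p : PrimeSpectrum R} {P : ℚ[X]}

theorem exists_eventuallyEval_socleLengthAt (M : Type*) [AddCommGroup M] [Module R M]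
    [Module.Finite R M] (I : Ideal R) (p : PrimeSpectrum R) :
    ∃ P : ℚ[X], EventuallyEval P fun n => socleLengthAt p (I ^ n • ⊤ : Submodule R M) := by
  simp_rw [socleLengthAt, localized_pow_smul_top]
  exact exists_eventuallyEval_socle _

theorem mem_stableAssociatedPrimes_of_ne_zero
    (hP : EventuallyEval P fun n => socleLengthAt p (I ^ n • ⊤ : Submodule R M)) (h0 : P ≠ 0) :
    p.asIdeal ∈ stableAssociatedPrimes I M :=
  (hP.eventually_ne_zero h0).mono fun _ h => mem_associatedPrimes_of_socleLengthAt_ne_zero h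

theorem supportDim_localizedModule_le
    (hp : Minimal (· ∈ associatedPrimes R (M ⧸ (I • ⊤ : Submodule R M))) p.asIdeal)
    (hP : EventuallyEval P fun n => socleLengthAt p (I ^ n • ⊤ : Submodule R M)) :
    Module.supportDim (Localization p.asIdeal.primeCompl)
      (LocalizedModule p.asIdeal.primeCompl M) ≤ P.degree.map (Nat.cast : ℕ → ℕ∞) + 1 := by
  have hIp : I ≤ p.asIdeal := le_of_mem_associatedPrimes (n := 1) (by rw [pow_one]; exact hp.1)
  have := nontrivial_localizedModule_of_mem_associatedPrimes le_rfl hp.1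
  obtain ⟨s, hs⟩ := exists_pow_maximalIdeal_smul_top_le hp
  simp_rw [socleLengthAt, localized_pow_smul_top] at hP
  rw [map_degree_add_one (ne_zero_of_eventuallyEval_socle (map_le_maximalIdeal hIp) hs hP)]
  exact supportDim_le_natDegree_add_one (map_le_maximalIdeal hIp) hs hP

theorem exists_degree_lt_max_of_mem_stableAssociatedPrimes
    (hp : p.asIdeal ∈ stableAssociatedPrimes I M)
    (hP : EventuallyEval P fun n => socleLengthAt p (I ^ n • ⊤ : Submodule R M)) :
    ∃ s : ℕ, (s : WithBot ℕ∞) ≤ analyticSpread I M ∧ P.degree < (max s 1 : ℕ) := by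
  obtain ⟨n, hn⟩ := Eventually.exists hp
  obtain ⟨m, hm, hpm⟩ := p.asIdeal.exists_le_maximal p.2.ne_top
  have := hm.isPrime
  have := nontrivial_localizedModule_of_mem_associatedPrimes hpm hn
  obtain ⟨s, hs, hgrowth⟩ := exists_hasGrowthAtMost_sum_spanFinrank_localAnalyticSpread
    (N := LocalizedModule m.primeCompl M)
    (map_le_maximalIdeal ((le_of_mem_associatedPrimes hn).trans hpm))
  refine ⟨s, hs.trans (le_iSup₂_of_le ⟨m, hm⟩ ⟨_, hp, hpm⟩ le_rfl), ?_⟩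
  simp_rw [socleLengthAt, localized_pow_smul_top] at hP
  refine degree_lt_of_hasGrowthAtMost_sum_card hP (fun k => ?_) hgrowth
  simp_rw [← localized_pow_smul_top]
  exact exists_span_eq_localized_card_le hpm (IsNoetherian.noetherian _)

theorem map_degree_add_one_le_analyticSpread
    (hP : EventuallyEval P fun n => socleLengthAt p (I ^ n • ⊤ : Submodule R M))
    (hI : analyticSpread I M ≠ 0) :
    P.degree.map (Nat.cast : ℕ → ℕ∞) + 1 ≤ analyticSpread I M := by
  rcases eq_or_ne P 0 with rfl | h0
  · exact bot_le
  obtain ⟨s, hs, hdeg⟩ := exists_degree_lt_max_of_mem_stableAssociatedPrimes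
    (mem_stableAssociatedPrimes_of_ne_zero hP h0) hP
  refine (map_degree_add_one_le_of_degree_lt hdeg).trans ?_
  have hpos : (0 : ℕ) < analyticSpread I M := (Nat.cast_nonneg' s |>.trans hs).lt_of_ne' hI
  have hone : (1 : ℕ) ≤ analyticSpread I M := by simpa using ENat.WithBot.add_one_le_iff.2 hpos
  rcases max_choice s 1 with h | h <;> rw [h]
  · exact hs
  · exact hone

end SocleLengthPolynomial

end ReducibilityIndex

open ReducibilityIndex

theorem theorem4p1 {R : Type*} [CommRing R] [IsNoetherianRing R]
    {M : Type*} [AddCommGroup M] [Module R M] [Module.Finite R M] (I : Ideal R) :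
    ∃ P : ℚ[X],
      (∀ᶠ n : ℕ in atTop,
        P.eval (n : ℚ) =
          (ReducibilityIndex.indexOfReducibility (I ^ n • ⊤ : Submodule R M) : ℚ)) ∧
      ReducibilityIndex.bigHeight I M ≤ P.degree.map (Nat.cast : ℕ → ℕ∞) + 1 ∧
      (ReducibilityIndex.analyticSpread I M ≠ 0 →
        P.degree.map (Nat.cast : ℕ → ℕ∞) + 1 ≤ ReducibilityIndex.analyticSpread I M) := by
  obtain ⟨T, hT⟩ := exists_finset_associatedPrimes (M := M) I
  choose P hP using exists_eventuallyEval_socleLengthAt M I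
  have hsum := EventuallyEval.sum T fun p _ => hP p
  refine ⟨∑ p ∈ T, P p, ?_, iSup₂_le fun p hp => ?_,
    fun hI => map_degree_sum_add_one_le fun p _ => map_degree_add_one_le_analyticSpread (hP p) hI⟩
  · filter_upwards [hsum] with n ⟨k, hk, heval⟩
    rw [← indexOfReducibility_eq_sum_socleLengthAt _ T (hT n), Nat.cast_inj] at hk
    rw [heval, hk]
  · have hpT : p ∈ T := hT 1 p (by rw [pow_one]; exact hp.1)
    have hdeg := (hP p).degree_le hsum (Eventually.of_forall fun n =>
      Finset.single_le_sum (f := fun p => socleLengthAt p (I ^ n • ⊤ : Submodule R M))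
        (fun _ _ => zero_le) hpT)
    exact (supportDim_localizedModule_le hp (hP p)).trans (map_degree_add_one_mono hdeg)
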